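/- Let $n,m$ be integers with $2\le m<n$, let $X$ be a random variable with values in $\{x_1,\dots,x_n\}$ and distribution $\mathbf p=(p_1,\dots,p_n)$, where $p_i=P\{X=x_i\}\ge 0$ and $\sum_i p_i=1$. Let $\mathcal F_m$ be the set of surjective functions from $\{x_1,\dots,x_n\}$ onto a set with $m$ elements, let $H$ denote Shannon entropy in bits, and put $$\alpha=1-\frac{1+\ln(\ln 2)}{\ln 2}.$$ A Huffman step on a partition of $\{x_1,\dots,x_n\}$ replaces two blocks of smallest probability (ties broken arbitrarily) by their union. Then $\alpha<0.0861$, and the following hold. (a) For every such $\mathbf p$ (with real entries), exactly $n-m$ Huffman steps can be carried out from the partition into singletons, and every $f\in\mathcal F_m$ whose fibres are the $m$ blocks obtained in this way satisfies $$\max_{g\in\mathcal F_m}H(g(X))-\alpha\;\le\; H(f(X))\;\le\;\max_{g\in\mathcal F_m}H(g(X)).$$ (b) There is an algorithm (a program for a random access machine with logarithmic cost) which, given $m$ and a distribution $\mathbf p$ with rational entries (numerators and denominators written in binary), where $2\le m<n$, halts in time polynomial in the number of bits of the input and outputs a function $f\in\mathcal F_m$ obtained by $n-m$ Huffman steps as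 in (a), so that $\max_{g\in\mathcal F_m}H(g(X))-\alpha\le H(f(X))\le\max_{g\in\mathcal F_m}H(g(X))$, together with a rational number $v$ such that $\bigl|v-\max_{g\in\mathcal F_m}H(g(X))\bigr|\le\alpha$. -/

import Mathlib

/-! ### Entropy of a function of a finite random variable -/

/-- Shannon entropy, in bits, of a finite vector of probabilities (`0 log 0 = 0`). -/
noncomputable def shannonEntropy {k : ℕ} (a : Fin k → ℝ) : ℝ :=
  -∑ i, a i * Real.logb 2 (a i)

/-- The distribution of `f(X)` when `X` takes the value `i` with probability `p i`. -/
noncomputable def distOfFun {n m : ℕ} (p : Fin n → ℝ) (f : Fin n → Fin m) : Fin m → ℝ :=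
  fun j => ∑ i with f i = j, p i

/-- The set of the values `H(f(X))`, where `f` ranges over the surjective functions onto a set
with `m` elements. -/
def entropyValues {n : ℕ} (m : ℕ) (p : Fin n → ℝ) : Set ℝ :=
  {h | ∃ f : Fin n → Fin m, Function.Surjective f ∧ h = shannonEntropy (distOfFun p f)}

/-- The constant `α = 1 - (1 + ln (ln 2)) / ln 2`. -/
noncomputable def alphaConst : ℝ :=
  1 - (1 + Real.log (Real.log 2)) / Real.log 2

/-! ### Huffman merge steps -/

/-- One Huffman step on a family `C` of disjoint blocks of outcomes, the weight of a block being
its total probability: two blocks of smallest weight (ties are broken arbitrarily) are replaced by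
their union. -/
def HuffmanStep {n : ℕ} (p : Fin n → ℝ) (C C' : Finset (Finset (Fin n))) : Prop :=
  ∃ A ∈ C, ∃ B ∈ C, A ≠ B ∧
    (∀ D ∈ C, D ≠ A → D ≠ B → ∑ i ∈ A, p i ≤ ∑ i ∈ D, p i ∧ ∑ i ∈ B, p i ≤ ∑ i ∈ D, p i) ∧
    C' = insert (A ∪ B) ((C.erase A).erase B)

/-- `HuffmanRun p k C`: the family `C` arises from the family of all singletons by exactly `k`
Huffman steps. -/
inductive HuffmanRun {n : ℕ} (p : Fin n → ℝ) : ℕ → Finset (Finset (Fin n)) → Prop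
  | zero : HuffmanRun p 0 (Finset.univ.image fun i => {i})
  | succ {k : ℕ} {C C' : Finset (Finset (Fin n))} :
      HuffmanRun p k C → HuffmanStep p C C' → HuffmanRun p (k + 1) C'

/-- `f` is a surjection onto `m` elements whose fibres are the blocks that result from exactly
`n - m` Huffman steps. -/
def IsHuffmanFun {n m : ℕ} (p : Fin n → ℝ) (f : Fin n → Fin m) : Prop :=
  Function.Surjective f ∧
    HuffmanRun p (n - m) (Finset.univ.image fun j => Finset.univ.filter fun i => f i = j)

/-! ### Random access machines with logarithmic cost

A program uses finitely many registers and finitely many arrays, all holding natural numbers.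
Every executed instruction and every test costs one plus the lengths in binary of all the numbers
it touches (operands, array indices, results); this is the usual logarithmic cost criterion, which
agrees with the running time of Turing machines up to a polynomial. -/

namespace RAM

/-- Contents of the registers and of the arrays. -/
structure State where
  reg : ℕ → ℕ
  arr : ℕ → ℕ → ℕ

/-- Arithmetic operations on natural numbers: sum, truncated difference, product, integer
quotient. -/
inductive Op
  | add
  | sub
  | mul
  | div

def Op.eval : Op → ℕ → ℕ → ℕ
  | .add, a, b => a + b
  | .sub, a, b => a - b
  | .mul, a, b => a * b
  | .div, a, b => a / b

/-- Programs. The letters `x y z` are names of registers and `a` is the name of an array. -/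
inductive Prog
  /-- do nothing -/
  | skip
  /-- `x := c` -/
  | const (x c : ℕ)
  /-- `x := y o z` -/
  | op (o : Op) (x y z : ℕ)
  /-- `x := a[y]` -/
  | load (x a y : ℕ)
  /-- `a[x] := y` -/
  | store (a x y : ℕ)
  /-- first `P`, then `Q` -/
  | seq (P Q : Prog)
  /-- if `x < y` then `P` else `Q` -/
  | ite (x y : ℕ) (P Q : Prog)
  /-- while `x < y` do `P` -/
  | while (x y : ℕ) (P : Prog)

def State.setReg (s : State) (x v : ℕ) : State :=
  { s with reg := Function.update s.reg x v }

def State.setArr (s : State) (a i v : ℕ) : State :=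
  { s with arr := Function.update s.arr a (Function.update (s.arr a) i v) }

/-- `Exec P s t s'`: started in state `s`, the program `P` halts in state `s'`, at total cost `t`.
Here `Nat.size v` is the number of binary digits of `v`. -/
inductive Exec : Prog → State → ℕ → State → Prop
  | skip (s : State) : Exec .skip s 1 s
  | const (s : State) (x c : ℕ) : Exec (.const x c) s (1 + c.size) (s.setReg x c)
  | op (s : State) (o : Op) (x y z : ℕ) :
      Exec (.op o x y z) s
        (1 + (s.reg y).size + (s.reg z).size + (o.eval (s.reg y) (s.reg z)).size)
        (s.setReg x (o.eval (s.reg y) (s.reg z)))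
  | load (s : State) (x a y : ℕ) :
      Exec (.load x a y) s (1 + (s.reg y).size + (s.arr a (s.reg y)).size)
        (s.setReg x (s.arr a (s.reg y)))
  | store (s : State) (a x y : ℕ) :
      Exec (.store a x y) s (1 + (s.reg x).size + (s.reg y).size)
        (s.setArr a (s.reg x) (s.reg y))
  | seq {P Q : Prog} {s s' s'' : State} {t u : ℕ} :
      Exec P s t s' → Exec Q s' u s'' → Exec (.seq P Q) s (t + u) s''
  | ite_true {x y : ℕ} {P Q : Prog} {s s' : State} {t : ℕ} :
      s.reg x < s.reg y → Exec P s t s' →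
        Exec (.ite x y P Q) s (1 + (s.reg x).size + (s.reg y).size + t) s'
  | ite_false {x y : ℕ} {P Q : Prog} {s s' : State} {t : ℕ} :
      ¬ s.reg x < s.reg y → Exec Q s t s' →
        Exec (.ite x y P Q) s (1 + (s.reg x).size + (s.reg y).size + t) s'
  | while_true {x y : ℕ} {P : Prog} {s s' s'' : State} {t u : ℕ} :
      s.reg x < s.reg y → Exec P s t s' → Exec (.while x y P) s' u s'' →
        Exec (.while x y P) s (1 + (s.reg x).size + (s.reg y).size + t + u) s''
  | while_false {x y : ℕ} {P : Prog} {s : State} :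
      ¬ s.reg x < s.reg y →
        Exec (.while x y P) s (1 + (s.reg x).size + (s.reg y).size) s

/-- The initial state for the instance `(p, m)`: register `0` holds `n`, register `1` holds `m`,
arrays `0` and `1` hold the numerators and the denominators of `p`, everything else is `0`. -/
def inputState {n : ℕ} (m : ℕ) (p : Fin n → ℚ) : State where
  reg x := if x = 0 then n else if x = 1 then m else 0
  arr a i :=
    if h : i < n then
      if a = 0 then (p ⟨i, h⟩).num.natAbs else if a = 1 then (p ⟨i, h⟩).den else 0
    else 0

/-- The number of bits of the instance `(p, m)`. -/
def inputSize {n : ℕ} (m : ℕ) (p : Fin n → ℚ) : ℕ :=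
  n.size + m.size + ∑ i, ((p i).num.natAbs.size + (p i).den.size)

/-- The state `s` shows the output `(f, v)`: array `0` holds the values of `f`, and `v` is the
quotient of the numbers in the registers `0` and `1`. -/
def IsOutput {n m : ℕ} (s : State) (f : Fin n → Fin m) (v : ℚ) : Prop :=
  (∀ i : Fin n, s.arr 0 i = f i) ∧ s.reg 1 ≠ 0 ∧ v = (s.reg 0 : ℚ) / (s.reg 1 : ℚ)

end RAM

/-! Huffman merging leaves a very rigid picture. If `w` is the combined weight of the last two
blocks merged, every block weighs at least `w / 2`, and every block heavier than `w` is an untouched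
singleton (`HuffmanRun.exists_threshold`). Only this shape is used to compare entropies.

Let `q` be the block weights of `f`, and let `ρ` be obtained from `q` by replacing the weights at
most `w` by their mean `c`. The averaged weights lie in `[w / 2, w]`. There `x log x` lies below its
chord, and optimizing over `w / c` shows that averaging costs at most `α` bits: `∑ q log q ≤ ∑ q log
ρ + α log 2` (`sum_mul_log_le_of_ratio_le_two`).

For a competitor `g`, give each fibre of `g` the largest value `r` that `ρ ∘ f` takes on it. Then `∑
q log ρ = ∑ p log (ρ ∘ f)` is at most the sum of the `g`-weights times `log r`. Gibbs' inequality
bounds this by minus the entropy of `g`, in nats, provided that `∑ r ≤ 1`. That holds because the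
`m` maximizers are distinct outcomes, each contributing `c` plus an excess, and a positive excess
occurs only at a heavy singleton, hence at most once for each heavy block. So `∑ r ≤ ∑ ρ = 1`
(`sum_mul_log_distOfFun_le`).

For the algorithm, the product `D` of the denominators has at most as many bits as the input, so
merging can be done on integer weights over `D`. Logarithms are replaced by binary lengths of 32nd
powers, which give an integer quotient between `H(f(X))` and `H(f(X)) + 1/16`
(`shannonEntropy_div_approx`). As `1/16 ≤ α` and `H(f(X))` lies within `α` below the maximum, the
quotient is within `α` of the maximum on either side. The cost is the number of instructions times a
uniform bound on the length of the numbers, which is what `Runs` records. -/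

/-! ### Numerical bounds for the constant. -/

theorem alphaConst_mul_log_two :
    alphaConst * Real.log 2 = Real.log 2 - 1 - Real.log (Real.log 2) := by
  have h : Real.log 2 ≠ 0 := (Real.log_pos one_lt_two).ne'
  unfold alphaConst
  field_simp
  ring

theorem alphaConst_lt : alphaConst < 0.0861 := by
  have h1 := Real.log_two_gt_d9
  have h2 := Real.log_two_lt_d9
  have hpos : 0 < Real.log 2 := by linarith
  -- `1.4426951` is just above `1 / log 2`, so this bounds `-log (log 2)` from above by `0.366532`;
  -- the margin below `0.0861` is small.
  have hexp : (1.4426951 : ℝ) ≤ Real.exp 0.366532 := by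
    have := Real.sum_le_exp_of_nonneg (x := 0.366532) (by norm_num) 8
    refine le_trans ?_ this
    norm_num [Finset.sum_range_succ, Nat.factorial]
  have hlog : -0.366532 ≤ Real.log (Real.log 2) := by
    rw [Real.le_log_iff_exp_le hpos, Real.exp_neg]
    refine (inv_anti₀ (by norm_num) hexp).trans ?_
    norm_num
    norm_num at h1
    linarith
  have h3 : alphaConst * Real.log 2 < 0.0861 * Real.log 2 := by
    rw [alphaConst_mul_log_two]
    norm_num at *
    linarith
  exact lt_of_mul_lt_mul_right h3 hpos.le

/-- The rounding error of the computed entropy is at most `1 / 16`; this makes it acceptable. -/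
theorem le_alphaConst : 1 / 16 ≤ alphaConst := by
  have h1 := Real.log_two_gt_d9
  have h2 := Real.log_two_lt_d9
  have hpos : 0 < Real.log 2 := by linarith
  have hexp : Real.exp 0.36 ≤ 1.4426 := by
    have := Real.exp_bound' (x := 0.36) (by norm_num) (by norm_num) (n := 6) (by norm_num)
    refine le_trans this ?_
    norm_num [Finset.sum_range_succ, Nat.factorial]
  have hlog : Real.log (Real.log 2) ≤ -0.36 := by
    rw [Real.log_le_iff_le_exp hpos, Real.exp_neg]
    refine le_trans ?_ (inv_anti₀ (Real.exp_pos _) hexp)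
    norm_num at *
    linarith
  have h3 : 1 / 16 * Real.log 2 ≤ alphaConst * Real.log 2 := by
    rw [alphaConst_mul_log_two]
    norm_num at *
    linarith
  exact le_of_mul_le_mul_right h3 hpos

/-! ### Entropy inequalities. -/

/-- On `[w / 2, w]` the function `x log x` lies below its chord. -/
theorem mul_log_le_chord {w x : ℝ} (hw : 0 < w) (h1 : w / 2 ≤ x) (h2 : x ≤ w) :
    x * Real.log x ≤ x * Real.log w + (x - w) * Real.log 2 := by
  have hx : 0 < x := by linarith
  -- Bernoulli's inequality `2 ^ s ≤ 1 + s` for `s = w / x - 1`, which lies in `[0, 1]`. Taking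
  -- logarithms and multiplying by `x` gives the chord.
  have hb := rpow_one_add_le_one_add_mul_self (s := 1) (p := w / x - 1) (by norm_num)
    (by rw [sub_nonneg, one_le_div hx]; exact h2)
    (by rw [sub_le_iff_le_add, div_le_iff₀ hx]; linarith)
  have hb' : (2 : ℝ) ^ (w / x - 1) ≤ w / x := by
    convert hb using 1 <;> norm_num
  have hl := Real.log_le_log (by positivity) hb'
  rw [Real.log_rpow two_pos, Real.log_div hw.ne' hx.ne'] at hl
  have := mul_le_mul_of_nonneg_left hl hx.le
  have e : x * ((w / x - 1) * Real.log 2) = (w - x) * Real.log 2 := by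
    field_simp
  rw [e] at this
  linarith

/-- Numbers within a factor two of each other: `∑ x log x` exceeds its value at the mean by at most
`α log 2` times the total. -/
theorem sum_mul_log_le_of_ratio_le_two {ι : Type*} (J : Finset ι) (q : ι → ℝ) {w c : ℝ}
    (hw : 0 ≤ w) (h1 : ∀ j ∈ J, w / 2 ≤ q j) (h2 : ∀ j ∈ J, q j ≤ w) (hJ : J.Nonempty)
    (hc : J.card * c = ∑ j ∈ J, q j) :
    ∑ j ∈ J, q j * Real.log (q j) ≤
      ∑ j ∈ J, q j * Real.log c + alphaConst * Real.log 2 * ∑ j ∈ J, q j := by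
  have hL : 0 < Real.log 2 := Real.log_pos one_lt_two
  rcases hw.eq_or_lt with rfl | hw
  · have hq : ∀ j ∈ J, q j = 0 := fun j hj => le_antisymm (h2 j hj) (by simpa using h1 j hj)
    have e1 : ∑ j ∈ J, q j * Real.log (q j) = 0 := Finset.sum_eq_zero fun j hj => by simp [hq j hj]
    have e2 : ∑ j ∈ J, q j * Real.log c = 0 := Finset.sum_eq_zero fun j hj => by simp [hq j hj]
    have e3 : ∑ j ∈ J, q j = 0 := Finset.sum_eq_zero hq
    simp [e1, e2, e3]
  have hT : 0 < ∑ j ∈ J, q j := Finset.sum_pos (fun j hj => by linarith [h1 j hj]) hJ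
  have hN : (0 : ℝ) < J.card := by exact_mod_cast hJ.card_pos
  have hc0 : 0 < c := by
    rw [← hc] at hT
    exact pos_of_mul_pos_right hT hN.le
  calc ∑ j ∈ J, q j * Real.log (q j)
      ≤ ∑ j ∈ J, (q j * Real.log w + (q j - w) * Real.log 2) :=
        Finset.sum_le_sum fun j hj => mul_log_le_chord hw (h1 j hj) (h2 j hj)
    _ = (J.card * c) * Real.log w + (J.card * c - J.card * w) * Real.log 2 := by
        rw [Finset.sum_add_distrib, ← Finset.sum_mul, ← Finset.sum_mul, Finset.sum_sub_distrib,
          Finset.sum_const, nsmul_eq_mul, hc]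
    _ ≤ _ := by
        rw [← Finset.sum_mul, ← hc, alphaConst_mul_log_two]
        -- The loss per unit of weight is `log (w / c) + log 2 - (w / c) log 2`. It is maximal at
        -- `(w / c) log 2 = 1`, with value `α log 2`; the tangent of `log` at `1` expresses this.
        have hu : Real.log (w / c * Real.log 2) ≤ w / c * Real.log 2 - 1 :=
          Real.log_le_sub_one_of_pos (by positivity)
        rw [Real.log_mul (by positivity) hL.ne', Real.log_div hw.ne' hc0.ne'] at hu
        have := mul_le_mul_of_nonneg_left hu (mul_pos hN hc0).le
        have e : J.card * c * (w / c * Real.log 2 - 1) = J.card * w * Real.log 2 - J.card * c := by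
          field_simp
        rw [e] at this
        linarith

/-- One term of Gibbs' inequality, from `log t ≤ t - 1` at `t = r / a`. The positivity of `r` is
required because of the convention `log 0 = 0`. -/
theorem mul_log_le_mul_log_add {a r : ℝ} (ha : 0 ≤ a) (hr : 0 ≤ r) (h : 0 < a → 0 < r) :
    a * Real.log r ≤ a * Real.log a + (r - a) := by
  rcases ha.eq_or_lt with rfl | ha
  · simpa using hr
  have hr := h ha
  have := Real.log_le_sub_one_of_pos (div_pos hr ha)
  rw [Real.log_div hr.ne' ha.ne'] at this
  have := mul_le_mul_of_nonneg_left this ha.le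
  have e : a * (r / a - 1) = r - a := by field_simp
  rw [e] at this
  linarith

theorem sum_distOfFun_mul {n m : ℕ} (p : Fin n → ℝ) (f : Fin n → Fin m) (h : Fin m → ℝ) :
    ∑ j, distOfFun p f j * h j = ∑ i, p i * h (f i) := by
  rw [← Finset.sum_fiberwise (s := Finset.univ) (g := f) (f := fun i => p i * h (f i))]
  refine Finset.sum_congr rfl fun j _ => ?_
  rw [distOfFun, Finset.sum_mul]
  refine Finset.sum_congr rfl fun i hi => ?_
  rw [(Finset.mem_filter.1 hi).2]

theorem sum_distOfFun {n m : ℕ} (p : Fin n → ℝ) (f : Fin n → Fin m) :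
    ∑ j, distOfFun p f j = ∑ i, p i := by
  simpa using sum_distOfFun_mul p f fun _ => 1

theorem le_distOfFun {n m : ℕ} {p : Fin n → ℝ} (hp : ∀ i, 0 ≤ p i) (f : Fin n → Fin m)
    (i : Fin n) : p i ≤ distOfFun p f (f i) :=
  Finset.single_le_sum (f := p) (fun i _ => hp i) (by simp)

theorem distOfFun_nonneg {n m : ℕ} {p : Fin n → ℝ} (hp : ∀ i, 0 ≤ p i) (f : Fin n → Fin m)
    (j : Fin m) : 0 ≤ distOfFun p f j :=
  Finset.sum_nonneg fun i _ => hp i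

/-- The shape of the partitions that a Huffman process reaches: for some threshold `w`, all the
blocks weigh at least `w / 2`, and the blocks heavier than `w` are singletons. Such a partition has
almost the largest entropy among all partitions with the same number of blocks. -/
theorem sum_mul_log_distOfFun_le {n m : ℕ} {p : Fin n → ℝ} (hp : p ∈ stdSimplex ℝ (Fin n))
    {f g : Fin n → Fin m} (hg : Function.Surjective g) {w : ℝ} (hw : 0 ≤ w)
    (hsing : ∀ j, (∃ i, (Finset.univ.filter fun i => f i = j) = {i}) ∨ distOfFun p f j ≤ w)
    (hlow : ∀ j, w / 2 ≤ distOfFun p f j) (hex : ∃ j, distOfFun p f j ≤ w) :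
    ∑ j, distOfFun p f j * Real.log (distOfFun p f j) ≤
      ∑ j, distOfFun p g j * Real.log (distOfFun p g j) + alphaConst * Real.log 2 := by
  obtain ⟨hp0, hp1⟩ := hp
  have hL : 0 < Real.log 2 := Real.log_pos one_lt_two
  have hα : 0 ≤ alphaConst * Real.log 2 := mul_nonneg (by linarith [le_alphaConst]) hL.le
  set q := distOfFun p f with hq
  have hq0 : ∀ j, 0 ≤ q j := distOfFun_nonneg hp0 f
  set J : Finset (Fin m) := Finset.univ.filter fun j => q j ≤ w with hJ
  have hJne : J.Nonempty := by
    obtain ⟨j, hj⟩ := hex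
    exact ⟨j, by simpa [hJ] using hj⟩
  have hN : (0 : ℝ) < J.card := by exact_mod_cast hJne.card_pos
  set c : ℝ := (∑ j ∈ J, q j) / J.card with hc
  have hcT : J.card * c = ∑ j ∈ J, q j := by rw [hc]; field_simp
  have hc0 : 0 ≤ c := div_nonneg (Finset.sum_nonneg fun j _ => hq0 j) hN.le
  have hcw : c ≤ w := by
    rw [hc, div_le_iff₀ hN, mul_comm]
    simpa using Finset.sum_le_card_nsmul J q w fun j hj => (Finset.mem_filter.1 hj).2
  -- The block weights with the light ones levelled to their mean; the total is still `1`.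
  set ρ : Fin m → ℝ := fun j => if q j ≤ w then c else q j with hρ
  have hρc : ∀ j, c ≤ ρ j := by
    intro j
    simp only [hρ]
    split_ifs with h
    · exact le_rfl
    · linarith
  have hρpos : ∀ i, 0 < p i → 0 < ρ (f i) := by
    intro i hi
    have h1 := le_distOfFun hp0 f i
    simp only [hρ]
    split_ifs with h
    · refine div_pos (lt_of_lt_of_le (hi.trans_le h1) ?_) hN
      exact Finset.single_le_sum (f := q) (fun j _ => hq0 j) (by simpa [hJ] using h)
    · exact hi.trans_le h1
  have hqρ : ∑ j, q j * Real.log (q j) ≤ ∑ j, q j * Real.log (ρ j) + alphaConst * Real.log 2 := by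
    rw [← Finset.sum_filter_add_sum_filter_not Finset.univ (fun j => q j ≤ w),
      ← Finset.sum_filter_add_sum_filter_not Finset.univ (fun j => q j ≤ w)
        (fun j => q j * Real.log (ρ j))]
    have e1 : ∑ j ∈ Finset.univ.filter (fun j => ¬ q j ≤ w), q j * Real.log (ρ j) =
        ∑ j ∈ Finset.univ.filter (fun j => ¬ q j ≤ w), q j * Real.log (q j) :=
      Finset.sum_congr rfl fun j hj => by
        simp only [hρ]
        rw [if_neg (Finset.mem_filter.1 hj).2]
    have e2 : ∑ j ∈ J, q j * Real.log (ρ j) = ∑ j ∈ J, q j * Real.log c :=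
      Finset.sum_congr rfl fun j hj => by
        simp only [hρ]
        rw [if_pos (Finset.mem_filter.1 hj).2]
    have h3 := sum_mul_log_le_of_ratio_le_two J q hw (fun j _ => hlow j)
      (fun j hj => (Finset.mem_filter.1 hj).2) hJne hcT
    have h4 : ∑ j ∈ J, q j ≤ 1 := by
      rw [← hp1, ← sum_distOfFun p f]
      exact Finset.sum_le_univ_sum_of_nonneg hq0
    have h5 := mul_le_mul_of_nonneg_left h4 hα
    rw [e1, e2]
    linarith
  -- In every fibre of `g`, an outcome `t l` whose `f`-block has the largest `ρ`; surjectivity of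
  -- `g` makes the fibre nonempty.
  have hmax : ∀ l : Fin m, ∃ i, g i = l ∧ ∀ i', g i' = l → ρ (f i') ≤ ρ (f i) := by
    intro l
    obtain ⟨i₀, hi₀⟩ := hg l
    obtain ⟨i, hi, h⟩ := Finset.exists_max_image (Finset.univ.filter fun i => g i = l)
      (fun i => ρ (f i)) ⟨i₀, by simpa using hi₀⟩
    exact ⟨i, by simpa using hi, fun i' hi' => h i' (by simpa using hi')⟩
  choose t htg htmax using hmax
  have hρr : ∑ j, q j * Real.log (ρ j) ≤ ∑ l, distOfFun p g l * Real.log (ρ (f (t l))) := by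
    rw [hq, sum_distOfFun_mul, sum_distOfFun_mul p g fun l => Real.log (ρ (f (t l)))]
    refine Finset.sum_le_sum fun i _ => ?_
    rcases (hp0 i).eq_or_lt with h | h
    · simp [← h]
    · exact mul_le_mul_of_nonneg_left (Real.log_le_log (hρpos i h) (htmax _ i rfl)) (hp0 i)
  have hgibbs : ∑ l, distOfFun p g l * Real.log (ρ (f (t l))) ≤
      ∑ l, (distOfFun p g l * Real.log (distOfFun p g l) + (ρ (f (t l)) - distOfFun p g l)) := by
    refine Finset.sum_le_sum fun l _ => mul_log_le_mul_log_add (distOfFun_nonneg hp0 g l)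
      (hc0.trans (hρc _)) fun hl => ?_
    obtain ⟨i, hi, hpi⟩ := Finset.exists_lt_of_sum_lt (s := Finset.univ.filter fun i => g i = l)
      (f := fun _ => (0 : ℝ)) (g := p) (by simpa [distOfFun] using hl)
    exact (hρpos i hpi).trans_le (htmax l i (by simpa using hi))
  have hr : ∑ l, ρ (f (t l)) ≤ 1 := by
    -- The excess of `ρ ∘ f` over `c`. A heavy block is a singleton, so the excess summed over all
    -- outcomes is at most the excess summed over blocks. Since `t` is injective, its `m` values
    -- collect no more than that.
    set big : Fin n → ℝ := fun i => if q (f i) ≤ w then 0 else p i - c with hbig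
    have hfib : ∀ i, ¬ q (f i) ≤ w → (Finset.univ.filter fun i' => f i' = f i) = {i} := by
      intro i hi
      obtain ⟨i', hi'⟩ := (hsing (f i)).resolve_right hi
      have : i ∈ ({i'} : Finset (Fin n)) := hi' ▸ (by simp)
      rw [hi', Finset.mem_singleton.1 this]
    have hqp : ∀ i, ¬ q (f i) ≤ w → q (f i) = p i := by
      intro i hi
      rw [hq, distOfFun, hfib i hi, Finset.sum_singleton]
    have hb : ∀ i, ρ (f i) = c + big i := by
      intro i
      simp only [hρ, hbig]
      split_ifs with h
      · ring
      · rw [hqp i h]; ring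
    have hb0 : ∀ i, 0 ≤ big i := fun i => by linarith [hb i, hρc (f i)]
    have ht : Function.Injective t := fun l l' h => by rw [← htg l, h, htg]
    have h1 : ∑ l, big (t l) ≤ ∑ i, big i := by
      rw [← Finset.sum_image (f := big) (g := t) (s := Finset.univ) fun l _ l' _ h => ht h]
      exact Finset.sum_le_univ_sum_of_nonneg hb0
    have h2 : ∑ i, big i ≤ ∑ j, (ρ j - c) := by
      rw [← Finset.sum_fiberwise (s := Finset.univ) (g := f)]
      refine Finset.sum_le_sum fun j _ => ?_
      by_cases hj : q j ≤ w
      · refine (Finset.sum_nonpos fun i hi => ?_).trans (sub_nonneg.2 (hρc j))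
        simp only [hbig]
        rw [(Finset.mem_filter.1 hi).2, if_pos hj]
      · obtain ⟨i, hi⟩ := (hsing j).resolve_right hj
        have hij : f i = j := by
          have : i ∈ Finset.univ.filter fun i => f i = j := hi ▸ Finset.mem_singleton_self i
          simpa using this
        rw [hi, Finset.sum_singleton]
        have := hb i
        rw [hij] at this
        linarith
    have h3 : ∑ j, ρ j = 1 := by
      rw [← hp1, ← sum_distOfFun p f, ← hq,
        ← Finset.sum_filter_add_sum_filter_not Finset.univ (fun j => q j ≤ w) ρ,
        ← Finset.sum_filter_add_sum_filter_not Finset.univ (fun j => q j ≤ w) q]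
      congr 1
      · rw [← hJ, ← hcT, ← nsmul_eq_mul, ← Finset.sum_const]
        exact Finset.sum_congr rfl fun j hj => if_pos (Finset.mem_filter.1 hj).2
      · exact Finset.sum_congr rfl fun j hj => if_neg (Finset.mem_filter.1 hj).2
    simp only [hb, Finset.sum_add_distrib]
    rw [Finset.sum_sub_distrib, h3] at h2
    linarith
  rw [Finset.sum_add_distrib, Finset.sum_sub_distrib, sum_distOfFun, hp1] at hgibbs
  linarith

/-! ### Huffman partitions are nearly optimal. -/

theorem shannonEntropy_mul_log_two {k : ℕ} (a : Fin k → ℝ) :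
    shannonEntropy a * Real.log 2 = -∑ i, a i * Real.log (a i) := by
  have h : Real.log 2 ≠ 0 := (Real.log_pos one_lt_two).ne'
  simp only [shannonEntropy, Real.logb, neg_mul, Finset.sum_mul]
  congr 1
  refine Finset.sum_congr rfl fun i _ => ?_
  field_simp

/-- Along a Huffman run all the blocks weigh at least half as much as the last block formed, and
the blocks heavier than that are singletons. -/
theorem HuffmanRun.exists_threshold {n k : ℕ} {p : Fin n → ℝ} {C : Finset (Finset (Fin n))}
    (hp : ∀ i, 0 ≤ p i) (h : HuffmanRun p k C) :
    ∃ w : ℝ, 0 ≤ w ∧ (∀ D ∈ C, (∃ i, D = {i}) ∨ ∑ i ∈ D, p i ≤ w) ∧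
      (∀ D ∈ C, w / 2 ≤ ∑ i ∈ D, p i) ∧ (k ≠ 0 → ∃ D ∈ C, ∑ i ∈ D, p i ≤ w) := by
  induction h with
  | zero =>
    refine ⟨0, le_rfl, fun D hD => .inl ?_, fun D _ => ?_, fun h => absurd rfl h⟩
    · obtain ⟨i, -, rfl⟩ := Finset.mem_image.1 hD
      exact ⟨i, rfl⟩
    · simpa using Finset.sum_nonneg fun i _ => hp i
  | @succ k C C' _ hs ih =>
    obtain ⟨w, hw, hsing, hlow, -⟩ := ih
    obtain ⟨A, hA, B, hB, -, hmin, rfl⟩ := hs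
    -- Subadditivity suffices, so disjointness of the blocks need not be carried through the
    -- induction.
    have hAB : ∑ i ∈ A ∪ B, p i ≤ ∑ i ∈ A, p i + ∑ i ∈ B, p i := by
      rw [← Finset.sum_union_inter]
      exact le_add_of_nonneg_right (Finset.sum_nonneg fun i _ => hp i)
    have hA' : ∑ i ∈ A, p i ≤ ∑ i ∈ A ∪ B, p i :=
      Finset.sum_le_sum_of_subset_of_nonneg Finset.subset_union_left fun i _ _ => hp i
    have hB' : ∑ i ∈ B, p i ≤ ∑ i ∈ A ∪ B, p i :=
      Finset.sum_le_sum_of_subset_of_nonneg Finset.subset_union_right fun i _ _ => hp i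
    have hwA := hlow A hA
    have hwB := hlow B hB
    -- The new threshold is no smaller than the old one, since both merged blocks weigh at least `w
    -- / 2`. The union and every remaining block weigh at least as much as each of `A` and `B`,
    -- hence at least half their sum.
    refine ⟨∑ i ∈ A, p i + ∑ i ∈ B, p i, by linarith, fun D hD => ?_, fun D hD => ?_,
      fun _ => ⟨A ∪ B, Finset.mem_insert_self _ _, hAB⟩⟩
    · rcases Finset.mem_insert.1 hD with rfl | hD
      · exact .inr hAB
      · rcases hsing D (Finset.mem_of_mem_erase (Finset.mem_of_mem_erase hD)) with h | h
        · exact .inl h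
        · exact .inr (by linarith)
    · rcases Finset.mem_insert.1 hD with rfl | hD
      · linarith
      · have hDB := Finset.ne_of_mem_erase hD
        have hD := Finset.mem_of_mem_erase hD
        have := hmin D (Finset.mem_of_mem_erase hD) (Finset.ne_of_mem_erase hD) hDB
        linarith

theorem IsHuffmanFun.entropy_le {n m : ℕ} (hmn : m < n) {p : Fin n → ℝ}
    (hp : p ∈ stdSimplex ℝ (Fin n)) {f g : Fin n → Fin m} (hf : IsHuffmanFun p f)
    (hg : Function.Surjective g) :
    shannonEntropy (distOfFun p g) - alphaConst ≤ shannonEntropy (distOfFun p f) := by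
  obtain ⟨w, hw, hsing, hlow, hex⟩ := hf.2.exists_threshold hp.1
  have hmem : ∀ j, (Finset.univ.filter fun i => f i = j) ∈
      Finset.univ.image fun j => Finset.univ.filter fun i => f i = j :=
    fun j => Finset.mem_image_of_mem _ (Finset.mem_univ j)
  have := sum_mul_log_distOfFun_le hp hg hw (fun j => hsing _ (hmem j)) (fun j => hlow _ (hmem j))
    (by
      -- As `m < n`, at least one merge took place, so the set of light blocks is nonempty.
      obtain ⟨D, hD, h⟩ := hex (by omega)
      obtain ⟨j, -, rfl⟩ := Finset.mem_image.1 hD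
      exact ⟨j, h⟩)
  refine le_of_mul_le_mul_right ?_ (Real.log_pos one_lt_two)
  rw [sub_mul, shannonEntropy_mul_log_two, shannonEntropy_mul_log_two]
  linarith

theorem exists_isGreatest_entropyValues {n m : ℕ} (p : Fin n → ℝ) (f : Fin n → Fin m)
    (hf : Function.Surjective f) : ∃ M, IsGreatest (entropyValues m p) M := by
  have hfin : (entropyValues m p).Finite :=
    (Set.finite_range fun f : Fin n → Fin m => shannonEntropy (distOfFun p f)).subset (by
      rintro _ ⟨f, -, rfl⟩
      exact ⟨f, rfl⟩)
  obtain ⟨M, hM, h⟩ := Set.exists_max_image _ id hfin ⟨_, f, hf, rfl⟩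
  exact ⟨M, hM, fun x hx => h x hx⟩

theorem IsHuffmanFun.entropy_bounds {n m : ℕ} (hmn : m < n) {p : Fin n → ℝ}
    (hp : p ∈ stdSimplex ℝ (Fin n)) {f : Fin n → Fin m} (hf : IsHuffmanFun p f) {M : ℝ}
    (hM : IsGreatest (entropyValues m p) M) :
    M - alphaConst ≤ shannonEntropy (distOfFun p f) ∧ shannonEntropy (distOfFun p f) ≤ M := by
  obtain ⟨g, hg, hMg⟩ := hM.1
  exact ⟨hMg ▸ hf.entropy_le hmn hp hg, hM.2 ⟨f, hf.1, rfl⟩⟩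

/-! ### Huffman steps on labellings -/

/-- The block of the outcomes with label `j`. -/
def labelBlock {n : ℕ} (F : Fin n → ℕ) (j : ℕ) : Finset (Fin n) :=
  Finset.univ.filter fun i => F i = j

/-- The family of the blocks with labels below `r`. -/
def labelBlocks {n : ℕ} (F : Fin n → ℕ) (r : ℕ) : Finset (Finset (Fin n)) :=
  (Finset.range r).image (labelBlock F)

/-- The labels in use are exactly those below `r`. -/
def IsLabelling {n : ℕ} (F : Fin n → ℕ) (r : ℕ) : Prop :=
  (∀ i, F i < r) ∧ ∀ j < r, ∃ i, F i = j

theorem mem_labelBlock {n : ℕ} {F : Fin n → ℕ} {j : ℕ} {i : Fin n} :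
    i ∈ labelBlock F j ↔ F i = j := by
  simp [labelBlock]

theorem IsLabelling.labelBlock_injOn {n r : ℕ} {F : Fin n → ℕ} (h : IsLabelling F r) :
    Set.InjOn (labelBlock F) (Set.Iio r) := by
  intro j hj j' _ e
  obtain ⟨i, hi⟩ := h.2 j hj
  have : i ∈ labelBlock F j' := e ▸ mem_labelBlock.2 hi
  exact hi.symm.trans (mem_labelBlock.1 this)

/-- The relabelling which moves the last block `q` to the place `A` and merges the block that was
there into the one at the place `B`. -/
def relabel (q A B : ℕ) : ℕ → ℕ :=
  Function.update (Function.update id q A) A B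

/-- The old label of the block which is at place `j` after the last block `q` has been moved to the
place `A`. -/
def movedFrom (q A j : ℕ) : ℕ :=
  if j = A then q else j

/-- The order of the two updates makes this true also when `A = q`, where nothing has to be moved,
and when `B = A`, where the merge partner is the block just moved from `q`. -/
theorem relabel_eq_iff {q A B x j : ℕ} (hj : j < q) :
    relabel q A B x = j ↔ x = movedFrom q A j ∨ j = B ∧ x = A := by
  simp only [relabel, movedFrom, Function.update_apply, id]
  grind

theorem labelBlock_relabel {n q A B j : ℕ} {F : Fin n → ℕ} (hj : j < q) :
    labelBlock (relabel q A B ∘ F) j =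
      if j = B then labelBlock F A ∪ labelBlock F (movedFrom q A B)
      else labelBlock F (movedFrom q A j) := by
  ext i
  rw [mem_labelBlock, Function.comp, relabel_eq_iff hj]
  split_ifs with hjB
  · subst hjB
    simp [mem_labelBlock, or_comm]
  · simp [mem_labelBlock, hjB]

theorem movedFrom_le {q A j : ℕ} (hj : j < q) : movedFrom q A j ≤ q := by
  unfold movedFrom; split_ifs <;> omega

theorem movedFrom_ne {q A j : ℕ} (hj : j < q) : movedFrom q A j ≠ A := by
  unfold movedFrom; split_ifs <;> omega

theorem exists_movedFrom_eq {q A x : ℕ} (hx : x ≤ q) (hA : A ≤ q) (hne : x ≠ A) :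
    ∃ j < q, movedFrom q A j = x := by
  by_cases h : x = q
  · exact ⟨A, by omega, by simp [movedFrom, h]⟩
  · exact ⟨x, by omega, by simp [movedFrom, hne]⟩

theorem movedFrom_inj {q A j j' : ℕ} (hj : j < q) (hj' : j' < q)
    (h : movedFrom q A j = movedFrom q A j') : j = j' := by
  unfold movedFrom at h; split_ifs at h <;> omega

theorem IsLabelling.relabel {n q A B : ℕ} {F : Fin n → ℕ} (h : IsLabelling F (q + 1)) (hA : A ≤ q)
    (hB : B < q) : IsLabelling (relabel q A B ∘ F) q := by
  constructor
  · intro i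
    have := h.1 i
    simp only [_root_.relabel, Function.comp, Function.update_apply, id]
    grind
  · intro j hj
    obtain ⟨i, hi⟩ := h.2 (movedFrom q A j) (Nat.lt_succ_of_le (movedFrom_le hj))
    exact ⟨i, (relabel_eq_iff hj).2 (.inl hi)⟩

/-- `movedFrom q A` is a bijection from the places below `q` onto the labels other than `A`. Hence a
minimum over all labels, followed by a minimum over the places left after the hole at `A` is filled,
yields two lightest blocks. -/
theorem IsLabelling.huffmanStep_relabel {n q A B : ℕ} {p : Fin n → ℝ} {F : Fin n → ℕ}
    (h : IsLabelling F (q + 1)) (hA : A ≤ q) (hB : B < q)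
    (hminA : ∀ j ≤ q, ∑ i ∈ labelBlock F A, p i ≤ ∑ i ∈ labelBlock F j, p i)
    (hminB : ∀ j < q, ∑ i ∈ labelBlock F (movedFrom q A B), p i ≤
      ∑ i ∈ labelBlock F (movedFrom q A j), p i) :
    HuffmanStep p (labelBlocks F (q + 1)) (labelBlocks (_root_.relabel q A B ∘ F) q) := by
  have hmem : ∀ j ≤ q, labelBlock F j ∈ labelBlocks F (q + 1) := fun j hj =>
    Finset.mem_image_of_mem _ (Finset.mem_range.2 (Nat.lt_succ_of_le hj))
  have hinj : ∀ j ≤ q, ∀ j' ≤ q, labelBlock F j = labelBlock F j' → j = j' :=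
    fun j hj j' hj' e => h.labelBlock_injOn (Nat.lt_succ_of_le hj) (Nat.lt_succ_of_le hj') e
  refine ⟨labelBlock F A, hmem A hA, labelBlock F (movedFrom q A B), hmem _ (movedFrom_le hB),
    fun e => movedFrom_ne hB (hinj _ hA _ (movedFrom_le hB) e).symm, ?_, ?_⟩
  · intro D hD hDA _
    obtain ⟨x, hx, rfl⟩ := Finset.mem_image.1 hD
    have hx := Nat.le_of_lt_succ (Finset.mem_range.1 hx)
    obtain ⟨j, hj, rfl⟩ := exists_movedFrom_eq hx hA fun e => hDA (e ▸ rfl)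
    exact ⟨hminA _ hx, hminB j hj⟩
  · ext D
    simp only [labelBlocks, Finset.mem_image, Finset.mem_range, Finset.mem_insert,
      Finset.mem_erase]
    constructor
    · rintro ⟨j, hj, rfl⟩
      rw [labelBlock_relabel hj]
      split_ifs with hjB
      · exact .inl rfl
      · refine .inr ⟨fun e => hjB ?_, fun e => ?_, movedFrom q A j,
          Nat.lt_succ_of_le (movedFrom_le hj), rfl⟩
        · exact movedFrom_inj hj hB (hinj _ (movedFrom_le hj) _ (movedFrom_le hB) e)
        · exact movedFrom_ne hj (hinj _ (movedFrom_le hj) _ hA e)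
    · rintro (rfl | ⟨hDB, hDA, x, hx, rfl⟩)
      · exact ⟨B, hB, by rw [labelBlock_relabel hB, if_pos rfl]⟩
      · obtain ⟨j, hj, rfl⟩ := exists_movedFrom_eq (Nat.le_of_lt_succ hx) hA fun e => hDA (e ▸ rfl)
        refine ⟨j, hj, ?_⟩
        rw [labelBlock_relabel hj, if_neg]
        rintro rfl
        exact hDB rfl

theorem isLabelling_val (n : ℕ) : IsLabelling (fun i : Fin n => (i : ℕ)) n :=
  ⟨fun i => i.2, fun j hj => ⟨⟨j, hj⟩, rfl⟩⟩

theorem huffmanRun_zero_val {n : ℕ} (p : Fin n → ℝ) :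
    HuffmanRun p 0 (labelBlocks (fun i : Fin n => (i : ℕ)) n) := by
  convert HuffmanRun.zero (p := p) using 1
  ext D
  simp only [labelBlocks, Finset.mem_image, Finset.mem_range, Finset.mem_univ, true_and]
  constructor
  · rintro ⟨j, hj, rfl⟩
    exact ⟨⟨j, hj⟩, by ext i; simp [mem_labelBlock, Fin.ext_iff]⟩
  · rintro ⟨i, rfl⟩
    exact ⟨i, i.2, by ext i'; simp [mem_labelBlock, Fin.ext_iff]⟩

theorem exists_huffmanRun {n : ℕ} (p : Fin n → ℝ) (k : ℕ) (hk : k < n) :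
    ∃ F : Fin n → ℕ, IsLabelling F (n - k) ∧ HuffmanRun p k (labelBlocks F (n - k)) := by
  induction k with
  | zero => exact ⟨_, isLabelling_val n, huffmanRun_zero_val p⟩
  | succ k ih =>
    obtain ⟨F, hF, hrun⟩ := ih (by omega)
    obtain ⟨q, hq⟩ : ∃ q, n - k = q + 1 := ⟨n - k - 1, by omega⟩
    have hq' : n - (k + 1) = q := by omega
    rw [hq] at hF hrun
    rw [hq']
    obtain ⟨A, hA, hminA⟩ := Finset.exists_min_image (Finset.range (q + 1))
      (fun j => ∑ i ∈ labelBlock F j, p i) ⟨0, by simp⟩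
    obtain ⟨B, hB, hminB⟩ := Finset.exists_min_image (Finset.range q)
      (fun j => ∑ i ∈ labelBlock F (movedFrom q A j), p i) ⟨0, by simp; omega⟩
    simp only [Finset.mem_range] at hA hB hminA hminB
    have hA' := Nat.le_of_lt_succ hA
    exact ⟨_, hF.relabel hA' hB, hrun.succ (hF.huffmanStep_relabel hA' hB
      (fun j hj => hminA j (Nat.lt_succ_of_le hj)) hminB)⟩

theorem isHuffmanFun_of_labelling {n m : ℕ} {p : Fin n → ℝ} {F : Fin n → ℕ} (hF : IsLabelling F m)
    (hrun : HuffmanRun p (n - m) (labelBlocks F m)) :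
    IsHuffmanFun p fun i => (⟨F i, hF.1 i⟩ : Fin m) := by
  refine ⟨fun j => ?_, ?_⟩
  · obtain ⟨i, hi⟩ := hF.2 j j.2
    exact ⟨i, Fin.ext hi⟩
  · convert hrun using 1
    ext D
    simp only [labelBlocks, Finset.mem_image, Finset.mem_range, Finset.mem_univ, true_and]
    constructor
    · rintro ⟨j, rfl⟩
      exact ⟨j, j.2, by ext i; simp [mem_labelBlock, Fin.ext_iff]⟩
    · rintro ⟨j, hj, rfl⟩
      exact ⟨⟨j, hj⟩, by ext i; simp [mem_labelBlock, Fin.ext_iff]⟩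

theorem exists_isHuffmanFun {n m : ℕ} (p : Fin n → ℝ) (hm : 2 ≤ m) (hmn : m < n) :
    ∃ f : Fin n → Fin m, IsHuffmanFun p f := by
  obtain ⟨F, hF, hrun⟩ := exists_huffmanRun p (n - m) (by omega)
  have e : n - (n - m) = m := by omega
  rw [e] at hF hrun
  exact ⟨_, isHuffmanFun_of_labelling hF hrun⟩

/-! ### Total correctness of programs, with a bound on the cost -/

namespace RAM

infixr:60 " ;; " => Prog.seq

theorem State.setReg_reg (s : State) (x v y : ℕ) :
    (s.setReg x v).reg y = if y = x then v else s.reg y := by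
  simp [State.setReg, Function.update_apply]

theorem State.setReg_arr (s : State) (x v : ℕ) : (s.setReg x v).arr = s.arr := rfl

theorem State.setArr_reg (s : State) (a i v : ℕ) : (s.setArr a i v).reg = s.reg := rfl

theorem State.setArr_arr (s : State) (a i v b : ℕ) :
    (s.setArr a i v).arr b = if b = a then Function.update (s.arr a) i v else s.arr b := by
  simp [State.setArr, Function.update_apply]

/-- All the numbers in registers and arrays are below `W`. -/
def State.Bounded (W : ℕ) (s : State) : Prop :=
  (∀ x, s.reg x < W) ∧ ∀ a i, s.arr a i < W

theorem State.Bounded.setReg {W : ℕ} {s : State} (h : s.Bounded W) {v : ℕ} (hv : v < W) (x : ℕ) :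
    (s.setReg x v).Bounded W := by
  refine ⟨fun y => ?_, h.2⟩
  rw [State.setReg_reg]
  split_ifs
  exacts [hv, h.1 y]

theorem State.Bounded.setArr {W : ℕ} {s : State} (h : s.Bounded W) {v : ℕ} (hv : v < W)
    (a i : ℕ) : (s.setArr a i v).Bounded W := by
  refine ⟨h.1, fun b j => ?_⟩
  rw [State.setArr_arr]
  split_ifs
  · rw [Function.update_apply]
    split_ifs
    exacts [hv, h.2 a j]
  · exact h.2 b j

/-- Started in `s`, the program `P` halts after at most `k` instructions and tests in a state that
satisfies `Q`, and all the numbers stay below `W` provided that they are so in `s`. -/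
def Runs (W k : ℕ) (P : Prog) (s : State) (Q : State → Prop) : Prop :=
  s.Bounded W → ∃ t s', Exec P s t s' ∧ t ≤ k * (1 + 3 * W.size) ∧ s'.Bounded W ∧ Q s'

theorem Runs.mono {W k k' : ℕ} {P : Prog} {s : State} {Q Q' : State → Prop}
    (h : Runs W k P s Q) (hk : k ≤ k') (hQ : ∀ s', Q s' → Q' s') : Runs W k' P s Q' := by
  intro hs
  obtain ⟨t, s', h1, h2, h3, h4⟩ := h hs
  exact ⟨t, s', h1, h2.trans (Nat.mul_le_mul_right _ hk), h3, hQ s' h4⟩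

theorem Runs.skip {W : ℕ} {s : State} {Q : State → Prop} (h : Q s) : Runs W 1 .skip s Q :=
  fun hs => ⟨1, s, .skip s, by omega, hs, h⟩

theorem Runs.const {W x c : ℕ} {s : State} {Q : State → Prop} (hc : c < W)
    (h : Q (s.setReg x c)) : Runs W 1 (.const x c) s Q := by
  intro hs
  refine ⟨_, _, .const s x c, ?_, hs.setReg hc x, h⟩
  have := Nat.size_le_size hc.le
  omega

theorem Runs.op {W x y z : ℕ} {o : Op} {s : State} {Q : State → Prop}
    (hv : o.eval (s.reg y) (s.reg z) < W)
    (h : Q (s.setReg x (o.eval (s.reg y) (s.reg z)))) : Runs W 1 (.op o x y z) s Q := by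
  intro hs
  refine ⟨_, _, .op s o x y z, ?_, hs.setReg hv x, h⟩
  have h1 := Nat.size_le_size hv.le
  have h2 := Nat.size_le_size (hs.1 y).le
  have h3 := Nat.size_le_size (hs.1 z).le
  omega

theorem Runs.load {W x a y : ℕ} {s : State} {Q : State → Prop}
    (h : Q (s.setReg x (s.arr a (s.reg y)))) : Runs W 1 (.load x a y) s Q := by
  intro hs
  refine ⟨_, _, .load s x a y, ?_, hs.setReg (hs.2 _ _) x, h⟩
  have h1 := Nat.size_le_size (hs.1 y).le
  have h2 := Nat.size_le_size (hs.2 a (s.reg y)).le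
  omega

theorem Runs.store {W x a y : ℕ} {s : State} {Q : State → Prop}
    (h : Q (s.setArr a (s.reg x) (s.reg y))) : Runs W 1 (.store a x y) s Q := by
  intro hs
  refine ⟨_, _, .store s a x y, ?_, hs.setArr (hs.1 _) _ _, h⟩
  have h1 := Nat.size_le_size (hs.1 x).le
  have h2 := Nat.size_le_size (hs.1 y).le
  omega

theorem Runs.seq {W k k' : ℕ} {P P' : Prog} {s : State} {Q : State → Prop}
    (h : Runs W k P s fun s' => Runs W k' P' s' Q) : Runs W (k + k') (P ;; P') s Q := by
  intro hs
  obtain ⟨t, s', h1, h2, h3, h4⟩ := h hs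
  obtain ⟨u, s'', h5, h6, h7, h8⟩ := h4 h3
  exact ⟨_, s'', .seq h1 h5, by rw [add_mul]; omega, h7, h8⟩

theorem Runs.const_seq {W k x c : ℕ} {P : Prog} {s : State} {Q : State → Prop} (hc : c < W)
    (h : Runs W k P (s.setReg x c) Q) : Runs W (k + 1) (.const x c ;; P) s Q :=
  add_comm k 1 ▸ Runs.seq (Runs.const hc h)

theorem Runs.add_seq {W k x y z : ℕ} {P : Prog} {s : State} {Q : State → Prop}
    (hv : s.reg y + s.reg z < W) (h : Runs W k P (s.setReg x (s.reg y + s.reg z)) Q) :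
    Runs W (k + 1) (.op .add x y z ;; P) s Q :=
  add_comm k 1 ▸ Runs.seq (Runs.op hv h)

theorem Runs.mul_seq {W k x y z : ℕ} {P : Prog} {s : State} {Q : State → Prop}
    (hv : s.reg y * s.reg z < W) (h : Runs W k P (s.setReg x (s.reg y * s.reg z)) Q) :
    Runs W (k + 1) (.op .mul x y z ;; P) s Q :=
  add_comm k 1 ▸ Runs.seq (Runs.op hv h)

/-- A truncated difference is at most its first operand, so the bound on the state already covers
the result; sums and products need a separate bound. -/
theorem Runs.sub_seq {W k x y z : ℕ} {P : Prog} {s : State} {Q : State → Prop}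
    (h : Runs W k P (s.setReg x (s.reg y - s.reg z)) Q) :
    Runs W (k + 1) (.op .sub x y z ;; P) s Q :=
  add_comm k 1 ▸ Runs.seq fun hs => Runs.op ((Nat.sub_le _ _).trans_lt (hs.1 y)) h hs

theorem Runs.div_seq {W k x y z : ℕ} {P : Prog} {s : State} {Q : State → Prop}
    (h : Runs W k P (s.setReg x (s.reg y / s.reg z)) Q) :
    Runs W (k + 1) (.op .div x y z ;; P) s Q :=
  add_comm k 1 ▸ Runs.seq fun hs => Runs.op ((Nat.div_le_self _ _).trans_lt (hs.1 y)) h hs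

theorem Runs.load_seq {W k x a y : ℕ} {P : Prog} {s : State} {Q : State → Prop}
    (h : Runs W k P (s.setReg x (s.arr a (s.reg y))) Q) :
    Runs W (k + 1) (.load x a y ;; P) s Q :=
  add_comm k 1 ▸ Runs.seq (Runs.load h)

theorem Runs.store_seq {W k x a y : ℕ} {P : Prog} {s : State} {Q : State → Prop}
    (h : Runs W k P (s.setArr a (s.reg x) (s.reg y)) Q) :
    Runs W (k + 1) (.store a x y ;; P) s Q :=
  add_comm k 1 ▸ Runs.seq (Runs.store h)

/-- Calling a subprogram with the specification `R`. -/
theorem Runs.call_seq {W k k' : ℕ} {P P' : Prog} {s : State} {Q R : State → Prop}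
    (h : Runs W k P s R) (h' : ∀ s', R s' → Runs W k' P' s' Q) :
    Runs W (k + k') (P ;; P') s Q :=
  Runs.seq (h.mono le_rfl h')

theorem Runs.ite {W k x y : ℕ} {P P' : Prog} {s : State} {Q : State → Prop}
    (h : s.reg x < s.reg y → Runs W k P s Q) (h' : ¬ s.reg x < s.reg y → Runs W k P' s Q) :
    Runs W (k + 1) (.ite x y P P') s Q := by
  intro hs
  have h2 := Nat.size_le_size (hs.1 x).le
  have h3 := Nat.size_le_size (hs.1 y).le
  by_cases hxy : s.reg x < s.reg y
  · obtain ⟨t, s', h4, h5, h6, h7⟩ := h hxy hs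
    exact ⟨_, s', .ite_true hxy h4, by rw [add_mul]; omega, h6, h7⟩
  · obtain ⟨t, s', h4, h5, h6, h7⟩ := h' hxy hs
    exact ⟨_, s', .ite_false hxy h4, by rw [add_mul]; omega, h6, h7⟩

/-- A loop which is run through `N` times, with the invariant `I`. -/
theorem Runs.while {W k N x y : ℕ} {P : Prog} {s : State} {I : ℕ → State → Prop} (h0 : I 0 s)
    (hend : ∀ s, I N s → ¬ s.reg x < s.reg y)
    (hstep : ∀ j < N, ∀ s, I j s → s.reg x < s.reg y ∧ Runs W k P s (I (j + 1))) :
    Runs W (N * (k + 1) + 1) (.while x y P) s (I N) := by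
  -- Induction on the number `d` of iterations still to come.
  suffices H : ∀ d j s, j + d = N → I j s → Runs W (d * (k + 1) + 1) (.while x y P) s (I N) from
    H N 0 s (zero_add N) h0
  intro d
  induction d with
  | zero =>
    rintro j s rfl hI hs
    have h2 := Nat.size_le_size (hs.1 x).le
    have h3 := Nat.size_le_size (hs.1 y).le
    exact ⟨_, s, .while_false (hend s hI), by omega, hs, hI⟩
  | succ d ih =>
    intro j s hj hI hs
    have h2 := Nat.size_le_size (hs.1 x).le
    have h3 := Nat.size_le_size (hs.1 y).le
    obtain ⟨hxy, hrun⟩ := hstep j (by omega) s hI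
    obtain ⟨t, s', h4, h5, h6, h7⟩ := hrun hs
    obtain ⟨u, s'', h8, h9, h10, h11⟩ := ih (j + 1) s' (by omega) h7 h6
    refine ⟨_, s'', .while_true hxy h4 h8, ?_, h10, h11⟩
    have e : ((d + 1) * (k + 1) + 1) * (1 + 3 * W.size) =
        (d * (k + 1) + 1) * (1 + 3 * W.size) + k * (1 + 3 * W.size) + (1 + 3 * W.size) := by ring
    rw [e]
    omega

/-- `for i = 0, …, y - 1 do P`, where `y` is a register and register `2` holds `1`. -/
def forLoop (i y : ℕ) (P : Prog) : Prog :=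
  .const i 0 ;; .while i y (P ;; .op .add i i 2)

/-- The body ends before the counter is incremented, so the invariant is demanded of the state with
the counter already advanced. Register `2` is the increment and has to survive the body. -/
theorem Runs.forLoop {W k N i y : ℕ} {P : Prog} {s : State} {I : ℕ → State → Prop} (hN : N < W)
    (h0 : I 0 (s.setReg i 0)) (hreg : ∀ j s, I j s → s.reg i = j ∧ s.reg y = N)
    (hstep : ∀ j < N, ∀ s, I j s → Runs W k P s fun s' =>
      s'.reg i = j ∧ s'.reg 2 = 1 ∧ I (j + 1) (s'.setReg i (j + 1))) :
    Runs W (N * (k + 2) + 2) (forLoop i y P) s (I N) := by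
  refine Runs.const_seq (by omega) (Runs.while h0 (fun s hs => ?_) fun j hj s hs => ⟨?_, ?_⟩)
  · have := hreg N s hs
    omega
  · have := hreg j s hs
    omega
  · refine Runs.call_seq (hstep j hj s hs) fun s' ⟨h1, h2, h3⟩ => Runs.op ?_ ?_
    · simp only [Op.eval, h1, h2]
      omega
    · simpa only [Op.eval, h1, h2] using h3

/-! ### Subprograms

Throughout, registers `2`, `3` and `5` hold the constants `1`, `0` and `2`. -/

/-- Puts into register `20` an index below register `8` at which array `2` is least. -/
def argmin : Prog :=
  .const 20 0 ;; forLoop 21 8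
    (.load 22 2 21 ;; .load 23 2 20 ;; .ite 22 23 (.op .add 20 21 3) .skip)

/-- Registers from `20` on are scratch space; callers rely on the smaller ones being preserved. -/
theorem runs_argmin {W r : ℕ} {s : State} (hr : 0 < r) (hrW : r < W) (h2 : s.reg 2 = 1)
    (h3 : s.reg 3 = 0) (h8 : s.reg 8 = r) :
    Runs W (r * 6 + 3) argmin s fun s' => (∀ x < 20, s'.reg x = s.reg x) ∧ s'.arr = s.arr ∧
      s'.reg 20 < r ∧ ∀ j < r, s.arr 2 (s'.reg 20) ≤ s.arr 2 j := by
  refine Runs.const_seq (by omega) ((Runs.forLoop (N := r) (k := 4) (I := fun j s' =>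
    (∀ x < 20, s'.reg x = s.reg x) ∧ s'.arr = s.arr ∧ s'.reg 21 = j ∧
      s'.reg 20 < r ∧ ∀ j' < j, s.arr 2 (s'.reg 20) ≤ s.arr 2 j') hrW ?_ ?_ ?_).mono le_rfl ?_)
  · refine ⟨fun x hx => ?_, rfl, ?_, ?_, by omega⟩ <;>
    simp [State.setReg_reg, hr]
    grind
  · rintro j s' ⟨h, -, h', -⟩
    exact ⟨h', by rw [h 8 (by omega), h8]⟩
  · rintro j hj s' ⟨hreg, harr, h21, h20, hmin⟩
    refine Runs.load_seq (Runs.load_seq (Runs.ite (fun hlt => Runs.op ?_ ?_)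
      (fun hlt => Runs.skip ?_)))
    all_goals simp [State.setReg_reg, State.setReg_arr, Op.eval, hreg, harr, h21, h2, h3] at hlt ⊢
    · omega
    · refine ⟨fun x hx => ?_, hj, fun j' hj' => ?_⟩
      · grind
      · rcases Nat.lt_or_eq_of_le hj' with h | rfl
        · exact hlt.le.trans (hmin j' h)
        · exact le_rfl
    · refine ⟨fun x hx => ?_, h20, fun j' hj' => ?_⟩
      · grind
      · rcases Nat.lt_or_eq_of_le hj' with h | rfl
        · exact hmin j' h
        · exact hlt
  · rintro s' ⟨h1, h2, -, h3, h4⟩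
    exact ⟨h1, h2, h3, h4⟩

/-- Replaces every entry of array `0` by its image under the table in array `3`. -/
def applyTable : Prog :=
  forLoop 21 0 (.load 22 0 21 ;; .load 22 3 22 ;; .store 0 21 22)

theorem runs_applyTable {W n : ℕ} {s : State} (hW : n < W) (h0 : s.reg 0 = n) (h2 : s.reg 2 = 1) :
    Runs W (n * 5 + 2) applyTable s fun s' => (∀ x < 20, s'.reg x = s.reg x) ∧
      (∀ a ≠ 0, s'.arr a = s.arr a) ∧ ∀ i < n, s'.arr 0 i = s.arr 3 (s.arr 0 i) := by
  refine (Runs.forLoop (N := n) (k := 3) (I := fun j s' =>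
    (∀ x < 20, s'.reg x = s.reg x) ∧ (∀ a ≠ 0, s'.arr a = s.arr a) ∧ s'.reg 21 = j ∧
      (∀ i < j, s'.arr 0 i = s.arr 3 (s.arr 0 i)) ∧ ∀ i ≥ j, s'.arr 0 i = s.arr 0 i)
    hW ?_ ?_ ?_).mono le_rfl ?_
  · refine ⟨fun x hx => ?_, fun _ _ => rfl, ?_, by omega, fun _ _ => rfl⟩ <;>
    simp [State.setReg_reg]
    omega
  · rintro j s' ⟨h, -, h', -⟩
    exact ⟨h', by rw [h 0 (by omega), h0]⟩
  · rintro j hj s' ⟨hreg, harr, h21, hlt, hge⟩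
    refine Runs.load_seq (Runs.load_seq (Runs.store ?_))
    simp [State.setReg_reg, State.setReg_arr, State.setArr_arr, State.setArr_reg, hreg, h21, h2,
      Function.update_apply]
    refine ⟨fun x hx => ?_, fun a ha => ?_, fun i hi => ?_, fun i hi => ?_⟩
    · grind
    · rw [if_neg ha, harr a ha]
    · split_ifs with h
      · rw [harr 3 (by omega), hge j le_rfl, h]
      · exact hlt i (by omega)
    · rw [if_neg (by omega), hge i (by omega)]
  · rintro s' ⟨h1, h2, -, h3, -⟩
    exact ⟨h1, h2, h3⟩

/-- One Huffman step. Array `0` holds the labels of the outcomes, register `8` the number of the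
blocks, array `2` their weights, and array `3` the identical table. -/
def mergeStep : Prog :=
  argmin ;; .op .add 10 20 3 ;; .load 11 2 10 ;; .op .sub 8 8 2 ;; .load 12 2 8 ;;
  .store 2 10 12 ;; .store 3 8 10 ;; argmin ;; .store 3 10 20 ;; .load 12 2 20 ;;
  .op .add 12 12 11 ;; .store 2 20 12 ;; applyTable ;; .store 3 10 10

/-- The two writes to the table, `q ↦ A` and then `A ↦ B`, are the two updates in `relabel`.
Resetting entry `A` afterwards makes the table the identity below `q`, the only range used from then
on. -/
theorem runs_mergeStep {W n q : ℕ} {s : State} (hq : 0 < q) (hqn : q < n) (hW : n < W)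
    (h0 : s.reg 0 = n) (h2 : s.reg 2 = 1) (h3 : s.reg 3 = 0) (h8 : s.reg 8 = q + 1)
    (hadd : ∀ j ≤ q, ∀ j' ≤ q, s.arr 2 j + s.arr 2 j' < W)
    (hlab : ∀ i < n, s.arr 0 i ≤ q) (htab : ∀ j ≤ q, s.arr 3 j = j) :
    Runs W (n * 17 + 19) mergeStep s fun s' => ∃ A ≤ q, ∃ B < q,
      (∀ j ≤ q, s.arr 2 A ≤ s.arr 2 j) ∧
      (∀ j < q, s.arr 2 (movedFrom q A B) ≤ s.arr 2 (movedFrom q A j)) ∧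
      (∀ x < 8, s'.reg x = s.reg x) ∧ s'.reg 8 = q ∧
      (∀ i < n, s'.arr 0 i = relabel q A B (s.arr 0 i)) ∧
      (∀ j < q, s'.arr 2 j = if j = B then s.arr 2 A + s.arr 2 (movedFrom q A B)
        else s.arr 2 (movedFrom q A j)) ∧
      ∀ j < q, s'.arr 3 j = j := by
  refine (Runs.call_seq (k' := (6 + ((q * 6 + 3) + (4 + ((n * 5 + 2) + 1)))))
    (runs_argmin (r := q + 1) (by omega) (by omega) h2 h3 h8) ?_).mono (by omega) fun _ h => h
  rintro s₁ ⟨hr₁, ha₁, hA, hminA⟩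
  have e0 : 6 + ((q * 6 + 3) + (4 + ((n * 5 + 2) + 1))) =
    ((q * 6 + 3) + (4 + ((n * 5 + 2) + 1))) + 6 := by ring
  rw [e0]
  have hA' := Nat.le_of_lt_succ hA
  refine Runs.add_seq ?_ (Runs.load_seq (Runs.sub_seq (Runs.load_seq (Runs.store_seq
    (Runs.store_seq ?_)))))
  · simp [hr₁, h3]; omega
  generalize hs₂ : State.setArr _ _ _ _ = s₂
  generalize s₁.reg 20 = A at *
  have hreg₂ : (∀ x < 8, s₂.reg x = s.reg x) ∧ s₂.reg 8 = q ∧ s₂.reg 10 = A ∧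
      s₂.reg 11 = s.arr 2 A := by
    subst hs₂
    simp [State.setReg_reg, State.setReg_arr, State.setArr_reg, hr₁, ha₁, h2, h3, h8]
    grind
  have harr₂ : s₂.arr 0 = s.arr 0 ∧ s₂.arr 2 = Function.update (s.arr 2) A (s.arr 2 q) ∧
      s₂.arr 3 = Function.update (s.arr 3) q A := by
    subst hs₂
    simp [State.setReg_reg, State.setReg_arr, State.setArr_arr, State.setArr_reg, hr₁, ha₁, h2, h3,
      h8]
  clear hs₂
  obtain ⟨hr₂, h8₂, h10₂, h11₂⟩ := hreg₂
  obtain ⟨ha0₂, ha2₂, ha3₂⟩ := harr₂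
  have hmoved : ∀ j < q, s₂.arr 2 j = s.arr 2 (movedFrom q A j) := by
    intro j hj
    rw [ha2₂, Function.update_apply, movedFrom]
    split_ifs <;> rfl
  refine Runs.call_seq (runs_argmin (r := q) hq (by omega) (by rw [hr₂ 2 (by omega), h2])
    (by rw [hr₂ 3 (by omega), h3]) h8₂) ?_
  rintro s₃ ⟨hr₃, ha₃, hB, hminB⟩
  rw [add_comm 4]
  refine Runs.store_seq (Runs.load_seq (Runs.add_seq ?_ (Runs.store_seq ?_)))
  · simp [State.setReg_reg, State.setArr_arr, State.setArr_reg, hr₃, ha₃, h11₂, hmoved _ hB]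
    exact hadd _ (movedFrom_le hB) _ hA'
  generalize hs₄ : State.setArr _ _ _ _ = s₄
  obtain ⟨B, hBdef⟩ : ∃ B, s₃.reg 20 = B := ⟨_, rfl⟩
  rw [hBdef] at hB hminB
  have hreg₄ : (∀ x < 12, s₄.reg x = s₂.reg x) ∧ s₄.arr 0 = s.arr 0 ∧
      s₄.arr 2 = Function.update (s₂.arr 2) B (s.arr 2 A + s.arr 2 (movedFrom q A B)) ∧
      s₄.arr 3 = Function.update (s₂.arr 3) A B := by
    subst hs₄
    simp [State.setReg_reg, State.setReg_arr, State.setArr_arr, State.setArr_reg, hr₃, ha₃, h11₂,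
      hmoved _ hB, h10₂, ha0₂, hBdef, add_comm]
    grind
  clear hs₄
  obtain ⟨hr₄, ha0₄, ha2₄, ha3₄⟩ := hreg₄
  refine Runs.call_seq (k' := 1) (runs_applyTable (n := n) hW
    (by rw [hr₄ 0 (by omega), hr₂ 0 (by omega), h0])
    (by rw [hr₄ 2 (by omega), hr₂ 2 (by omega), h2])) ?_
  rintro s₅ ⟨hr₅, ha₅, hlab₅⟩
  refine Runs.store ⟨A, hA', B, hB, fun j hj => hminA j (Nat.lt_succ_of_le hj), fun j hj => ?_,
    fun x hx => ?_, ?_, fun i hi => ?_, fun j hj => ?_, fun j hj => ?_⟩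
  · rw [← hmoved B hB, ← hmoved j hj]
    exact hminB j hj
  · rw [State.setArr_reg, hr₅ x (by omega), hr₄ x (by omega), hr₂ x hx]
  · rw [State.setArr_reg, hr₅ 8 (by omega), hr₄ 8 (by omega), h8₂]
  · rw [State.setArr_arr, if_neg (by omega), hlab₅ i hi, ha0₄, ha3₄, ha3₂]
    simp only [relabel, Function.update_apply, id, htab _ (hlab i hi)]
  · rw [State.setArr_arr, if_neg (by omega), ha₅ 2 (by omega), ha2₄, Function.update_apply,
      hmoved j hj]
  · rw [State.setArr_arr, if_pos rfl, ha₅ 3 (by omega), ha3₄, ha3₂, hr₅ 10 (by omega),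
      hr₄ 10 (by omega), h10₂]
    simp only [Function.update_apply]
    split_ifs with h h' <;> first | omega | exact htab j hj.le

/-- Puts into register `22` the number of binary digits of the 32nd power of register `20`. -/
def sizePow : Prog :=
  .op .mul 21 20 20 ;; .op .mul 21 21 21 ;; .op .mul 21 21 21 ;; .op .mul 21 21 21 ;;
  .op .mul 21 21 21 ;; .const 22 0 ;; .while 3 21 (.op .div 21 21 5 ;; .op .add 22 22 2)

theorem size_le_self (x : ℕ) : x.size ≤ x :=
  Nat.size_le.2 Nat.lt_two_pow_self

/-- Five squarings produce the 32nd power, and each halving removes one binary digit. -/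
theorem runs_sizePow {L a : ℕ} {s : State} (h2 : s.reg 2 = 1) (h3 : s.reg 3 = 0)
    (h5 : s.reg 5 = 2) (h20 : s.reg 20 = a) (ha : a ^ 32 < 2 ^ L) :
    Runs (2 ^ L) (L * 3 + 7) sizePow s fun s' => (∀ x ≤ 20, s'.reg x = s.reg x) ∧
      s'.arr = s.arr ∧ s'.reg 22 = (a ^ 32).size := by
  have hpow : ∀ k ≤ 32, k ≠ 0 → a ^ k < 2 ^ L := by
    intro k hk hk0
    rcases Nat.eq_zero_or_pos a with rfl | h
    · rw [zero_pow hk0]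
      positivity
    · exact (Nat.pow_le_pow_right h hk).trans_lt ha
  have hL : (a ^ 32).size ≤ L := Nat.size_le.2 ha
  have e : L * 3 + 7 = L * 3 + 1 + 6 := rfl
  rw [e]
  refine Runs.mul_seq ?_ (Runs.mul_seq ?_ (Runs.mul_seq ?_ (Runs.mul_seq ?_ (Runs.mul_seq ?_
    (Runs.const_seq (by positivity) ((Runs.while (N := (a ^ 32).size) (k := 2) (I := fun j s' =>
      (∀ x ≤ 20, s'.reg x = s.reg x) ∧ s'.arr = s.arr ∧ s'.reg 21 = a ^ 32 / 2 ^ j ∧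
        s'.reg 22 = j) ?_ ?_ ?_).mono ?_ ?_))))))
  · simpa [State.setReg_reg, h20, ← pow_succ, ← pow_two] using hpow 2 (by omega) (by omega)
  · simpa [State.setReg_reg, h20, ← pow_two, ← pow_mul] using hpow 4 (by omega) (by omega)
  · simpa [State.setReg_reg, h20, ← pow_two, ← pow_mul] using hpow 8 (by omega) (by omega)
  · simpa [State.setReg_reg, h20, ← pow_two, ← pow_mul] using hpow 16 (by omega) (by omega)
  · simpa [State.setReg_reg, h20, ← pow_two, ← pow_mul] using hpow 32 (by omega) (by omega)
  · simp [State.setReg_reg, State.setReg_arr, h20, ← pow_two, ← pow_mul]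
    intro x hx
    split_ifs <;> omega
  · rintro s' ⟨hr, -, h21, -⟩
    rw [hr 3 (by omega), h3, h21, Nat.div_eq_of_lt (Nat.lt_size_self _)]
    exact lt_irrefl 0
  · rintro j hj s' ⟨hr, harr, h21, h22⟩
    refine ⟨?_, Runs.div_seq (Runs.op ?_ ?_)⟩
    · rw [hr 3 (by omega), h3, h21]
      exact Nat.div_pos (Nat.lt_size.1 hj) (by positivity)
    · simp only [State.setReg_reg, Op.eval]
      norm_num
      rw [hr 2 (by omega), h2, h22]
      have := size_le_self (a ^ 32)
      omega
    · simp only [State.setReg_reg, State.setReg_arr, Op.eval]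
      norm_num
      rw [hr 2 (by omega), hr 5 (by omega), h2, h5, h21, h22, Nat.div_div_eq_div_mul, ← pow_succ]
      refine ⟨fun x hx => ?_, harr, rfl, rfl⟩
      rw [if_neg (by omega), if_neg (by omega), hr x hx]
  · omega
  · rintro s' ⟨h1, h2, -, h3⟩
    exact ⟨h1, h2, h3⟩

end RAM

/-! ### The stages of the program. -/

namespace RAM

/-- Brings the probabilities to the common denominator in register `4`, puts their numerators into
array `2`, and initializes the labels in array `0` and the table in array `3`. -/
def setup : Prog :=
  .const 2 1 ;; .const 4 1 ;; .const 5 2 ;;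
  forLoop 9 0 (.load 20 1 9 ;; .op .mul 4 4 20) ;;
  forLoop 9 0 (.load 20 0 9 ;; .load 21 1 9 ;; .op .mul 20 20 4 ;; .op .div 20 20 21 ;;
    .store 2 9 20 ;; .store 0 9 9 ;; .store 3 9 9) ;;
  .op .add 8 0 3

theorem runs_setup {W n D : ℕ} {s : State} (h0 : s.reg 0 = n) (h3 : s.reg 3 = 0) (hW : 2 < W)
    (hn : n < W) (hden : ∀ i < n, 0 < s.arr 1 i) (hnum : ∀ i < n, s.arr 0 i ≤ D)
    (hD : ∏ i ∈ Finset.range n, s.arr 1 i = D) (hDW : D * D < W) :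
    Runs W (n * 13 + 8) setup s fun s' => s'.reg 0 = n ∧ s'.reg 1 = s.reg 1 ∧ s'.reg 2 = 1 ∧
      s'.reg 3 = 0 ∧ s'.reg 4 = D ∧ s'.reg 5 = 2 ∧ s'.reg 8 = n ∧
      ∀ i < n, s'.arr 0 i = i ∧ s'.arr 2 i = s.arr 0 i * D / s.arr 1 i ∧ s'.arr 3 i = i := by
  have e : n * 13 + 8 = ((n * 4 + 2) + ((n * 9 + 2) + 1)) + 3 := by ring
  rw [e]
  refine Runs.const_seq (by omega) (Runs.const_seq (by omega) (Runs.const_seq (by omega)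
    (Runs.call_seq (Runs.forLoop (N := n) (k := 2) (I := fun j s' => s'.reg 0 = n ∧
      s'.reg 1 = s.reg 1 ∧ s'.reg 2 = 1 ∧ s'.reg 3 = 0 ∧
      s'.reg 4 = ∏ i ∈ Finset.range j, s.arr 1 i ∧ s'.reg 5 = 2 ∧ s'.reg 9 = j ∧ s'.arr = s.arr)
      hn ?_ ?_ ?_) fun s₁ ⟨h0₁, h1₁, h2₁, h3₁, h4₁, h5₁, h9₁, ha₁⟩ =>
    Runs.call_seq (Runs.forLoop (N := n) (k := 7) (I := fun j s' => s'.reg 0 = n ∧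
      s'.reg 1 = s.reg 1 ∧ s'.reg 2 = 1 ∧ s'.reg 3 = 0 ∧ s'.reg 4 = D ∧ s'.reg 5 = 2 ∧
      s'.reg 9 = j ∧ s'.arr 1 = s.arr 1 ∧ (∀ i ≥ j, s'.arr 0 i = s.arr 0 i) ∧
      ∀ i < j, s'.arr 0 i = i ∧ s'.arr 2 i = s.arr 0 i * D / s.arr 1 i ∧ s'.arr 3 i = i)
      hn ?_ ?_ ?_) fun s₂ ⟨h0₂, h1₂, h2₂, h3₂, h4₂, h5₂, h9₂, _, _, ha₂⟩ => Runs.op ?_ ?_)))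
  · simp [State.setReg_reg, State.setReg_arr, h0, h3]
  · rintro j s' ⟨h0', -, -, -, -, -, h9', -⟩
    exact ⟨h9', h0'⟩
  · rintro j hj s' ⟨h0', h1', h2', h3', h4', h5', h9', ha'⟩
    -- Denominators are at least `1`, so the partial products never exceed the full product `D`.
    have hprod : ∏ i ∈ Finset.range (j + 1), s.arr 1 i ≤ D := by
      rw [← hD]
      exact Finset.prod_le_prod_of_subset_of_one_le'
        (Finset.range_subset_range.2 hj) fun i hi _ => hden i (Finset.mem_range.1 hi)
    rw [Finset.prod_range_succ] at hprod
    have hDD : D ≤ D * D := Nat.le_mul_self D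
    refine Runs.load_seq (Runs.op ?_ ?_)
    · simp [State.setReg_reg, Op.eval, h4', h9', ha']
      omega
    · simp [State.setReg_reg, State.setReg_arr, Op.eval, h0', h1', h2', h3', h4', h5', h9', ha',
        Finset.prod_range_succ]
  · simp [State.setReg_reg, State.setReg_arr, h0₁, h1₁, h2₁, h3₁, h4₁, h5₁, ha₁, hD]
  · rintro j s' ⟨h0', -, -, -, -, -, h9', -⟩
    exact ⟨h9', h0'⟩
  · rintro j hj s' ⟨h0', h1', h2', h3', h4', h5', h9', ha1', hge, hlt⟩
    refine Runs.load_seq (Runs.load_seq (Runs.mul_seq ?_ (Runs.div_seq (Runs.store_seq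
      (Runs.store_seq (Runs.store ?_))))))
    · simp [State.setReg_reg, h4', h9', hge]
      exact (Nat.mul_le_mul_right D (hnum j hj)).trans_lt hDW
    · simp [State.setReg_reg, State.setReg_arr, State.setArr_arr, State.setArr_reg, h0', h1', h2',
        h3', h4', h5', h9', ha1', hge, Function.update_apply]
      refine ⟨fun i hi => ?_, fun i hi => ?_⟩
      · rw [if_neg (by omega), hge i (by omega)]
      · split_ifs with h
        · simp [h]
        · exact hlt i (by omega)
  · simp [Op.eval, h0₂, h3₂, hn]
  · simp [State.setReg_reg, State.setReg_arr, Op.eval, h0₂, h1₂, h2₂, h3₂, h4₂, h5₂]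
    exact ha₂

/-- Comparing integer weights over the common denominator `D` is comparing probabilities. Every
block weight is at most the total `D`, so all sums formed stay below `W`. -/
theorem runs_mergeLoop {W n m D : ℕ} {p : Fin n → ℝ} {a : Fin n → ℕ} {s : State} (hm : 0 < m)
    (hmn : m < n) (hW : n < W) (hDW : 2 * D < W) (hp : ∀ i, p i = a i / D)
    (hsum : ∑ i, a i = D) (h0 : s.reg 0 = n) (h1 : s.reg 1 = m) (h2 : s.reg 2 = 1)
    (h3 : s.reg 3 = 0) (h8 : s.reg 8 = n)
    (harr : ∀ i : Fin n, s.arr 0 i = i ∧ s.arr 2 i = a i ∧ s.arr 3 i = i) :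
    Runs W (n * (n * 17 + 20) + 1) (.while 1 8 mergeStep) s fun s' =>
      (∀ x < 8, s'.reg x = s.reg x) ∧ IsLabelling (fun i : Fin n => s'.arr 0 i) m ∧
      HuffmanRun p (n - m) (labelBlocks (fun i : Fin n => s'.arr 0 i) m) ∧
      ∀ j < m, s'.arr 2 j = ∑ i ∈ labelBlock (fun i : Fin n => s'.arr 0 i) j, a i := by
  have hlab0 : (fun i : Fin n => s.arr 0 i) = fun i : Fin n => (i : ℕ) :=
    funext fun i => (harr i).1
  refine (Runs.while (N := n - m) (k := n * 17 + 19) (I := fun k s' =>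
    (∀ x < 8, s'.reg x = s.reg x) ∧ s'.reg 8 = n - k ∧
      IsLabelling (fun i : Fin n => s'.arr 0 i) (n - k) ∧
      HuffmanRun p k (labelBlocks (fun i : Fin n => s'.arr 0 i) (n - k)) ∧
      (∀ j < n - k, s'.arr 2 j = ∑ i ∈ labelBlock (fun i : Fin n => s'.arr 0 i) j, a i) ∧
      ∀ j < n - k, s'.arr 3 j = j) ?_ ?_ ?_).mono ?_ ?_
  · refine ⟨fun _ _ => rfl, h8, hlab0 ▸ isLabelling_val n, hlab0 ▸ huffmanRun_zero_val p,
      fun j hj => ?_, fun j hj => (harr ⟨j, hj⟩).2.2⟩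
    have : labelBlock (fun i : Fin n => s.arr 0 i) j = {⟨j, hj⟩} := by
      ext i
      simp [mem_labelBlock, hlab0, Fin.ext_iff]
    rw [this, Finset.sum_singleton]
    exact (harr ⟨j, hj⟩).2.1
  · rintro s' ⟨hr, h8', -⟩
    rw [hr 1 (by omega), h1, h8']
    omega
  · rintro k hk s' ⟨hr, h8', hF, hrun, hwt, htab⟩
    refine ⟨by rw [hr 1 (by omega), h1, h8']; omega, ?_⟩
    obtain ⟨q, hq⟩ : ∃ q, n - k = q + 1 := ⟨n - k - 1, by omega⟩
    have hq' : n - (k + 1) = q := by omega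
    rw [hq] at h8' hF hrun hwt htab
    rw [hq']
    set F : Fin n → ℕ := fun i => s'.arr 0 i with hFdef
    have hle : ∀ j ≤ q, s'.arr 2 j ≤ D := by
      intro j hj
      rw [hwt j (by omega), ← hsum]
      exact Finset.sum_le_univ_sum_of_nonneg fun _ => Nat.zero_le _
    have hcmp : ∀ j ≤ q, ∀ j' ≤ q, s'.arr 2 j ≤ s'.arr 2 j' →
        ∑ i ∈ labelBlock F j, p i ≤ ∑ i ∈ labelBlock F j', p i := by
      intro j hj j' hj' h
      simp only [hp, ← Finset.sum_div]
      rw [hwt j (by omega), hwt j' (by omega)] at h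
      exact div_le_div_of_nonneg_right (by exact_mod_cast h) (Nat.cast_nonneg D)
    refine (runs_mergeStep (n := n) (q := q) (by omega) (by omega) hW
      (by rw [hr 0 (by omega), h0]) (by rw [hr 2 (by omega), h2]) (by rw [hr 3 (by omega), h3]) h8'
      (fun j hj j' hj' => by have := hle j hj; have := hle j' hj'; omega)
      (fun i hi => Nat.le_of_lt_succ (hF.1 ⟨i, hi⟩))
      fun j hj => htab j (by omega)).mono le_rfl ?_
    rintro s'' ⟨A, hA, B, hB, hminA, hminB, hr'', h8'', hlab'', hwt'', htab''⟩
    have hF'' : (fun i : Fin n => s''.arr 0 i) = relabel q A B ∘ F :=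
      funext fun i => hlab'' i i.2
    rw [hF'']
    refine ⟨fun x hx => (hr'' x hx).trans (hr x hx), h8'', hF.relabel hA hB,
      hrun.succ (hF.huffmanStep_relabel hA hB (fun j hj => hcmp A hA j hj (hminA j hj))
        fun j hj => hcmp _ (movedFrom_le hB) _ (movedFrom_le hj) (hminB j hj)),
      fun j hj => ?_, htab''⟩
    rw [hwt'' j hj, labelBlock_relabel hj]
    split_ifs
    · rw [hwt A (by omega), hwt _ (Nat.lt_succ_of_le (movedFrom_le hB)), Finset.sum_union]
      refine Finset.disjoint_left.2 fun i hi hi' => movedFrom_ne (A := A) hB ?_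
      exact (mem_labelBlock.1 hi').symm.trans (mem_labelBlock.1 hi)
    · exact hwt _ (Nat.lt_succ_of_le (movedFrom_le hj))
  · have : (n - m) * (n * 17 + 20) ≤ n * (n * 17 + 20) := Nat.mul_le_mul_right _ (Nat.sub_le n m)
    exact Nat.succ_le_succ this
  · rintro s' ⟨hr, -, hF, hrun, hwt, -⟩
    have e : n - (n - m) = m := by omega
    rw [e] at hF hrun hwt
    exact ⟨hr, hF, hrun, hwt⟩

/-- Computes an approximation of the entropy of the weights in array `2`. -/
def approxEntropy : Prog :=
  .const 6 0 ;;
  forLoop 9 1 (.load 20 2 9 ;; sizePow ;; .op .mul 22 22 20 ;; .op .add 6 6 22) ;;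
  .op .add 20 4 3 ;; sizePow ;; .op .add 22 22 2 ;; .op .mul 22 22 4 ;; .op .sub 0 22 6 ;;
  .const 7 32 ;; .op .mul 1 4 7

theorem runs_approxEntropy {L m D : ℕ} {s : State} {w : ℕ → ℕ} (h1 : s.reg 1 = m)
    (h2 : s.reg 2 = 1) (h3 : s.reg 3 = 0) (h4 : s.reg 4 = D) (h5 : s.reg 5 = 2) (hw : s.arr 2 = w)
    (hmL : m < 2 ^ L) (hwL : ∀ j < m, w j ^ 32 < 2 ^ L) (hDL : D ^ 32 < 2 ^ L)
    (hsum : ∑ j ∈ Finset.range m, (w j ^ 32).size * w j < 2 ^ L)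
    (hsize : ((D ^ 32).size + 1) * D < 2 ^ L) (hD0 : 0 < D) (hD32 : D * 32 < 2 ^ L) :
    Runs (2 ^ L) (m * (L * 3 + 12) + L * 3 + 16) approxEntropy s fun s' => s'.arr = s.arr ∧
      s'.reg 0 = ((D ^ 32).size + 1) * D - ∑ j ∈ Finset.range m, (w j ^ 32).size * w j ∧
      s'.reg 1 = D * 32 := by
  have e : m * (L * 3 + 12) + L * 3 + 16 =
    ((m * ((L * 3 + 7) + 2 + 1 + 2) + 2) + ((L * 3 + 7 + 5) + 1)) + 1 := by ring
  rw [e]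
  refine Runs.const_seq (by omega) (Runs.call_seq (Runs.forLoop (N := m)
    (I := fun j s' => s'.reg 1 = m ∧ s'.reg 2 = 1 ∧ s'.reg 3 = 0 ∧ s'.reg 4 = D ∧ s'.reg 5 = 2 ∧
      s'.reg 6 = ∑ j' ∈ Finset.range j, (w j' ^ 32).size * w j' ∧ s'.reg 9 = j ∧ s'.arr = s.arr)
      hmL ?_ ?_ ?_) fun s₁ ⟨h1₁, h2₁, h3₁, h4₁, h5₁, h6₁, h9₁, ha₁⟩ => ?_)
  · simp [State.setReg_reg, State.setReg_arr, h1, h2, h3, h4, h5]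
  · rintro j s' ⟨h1', -, -, -, -, -, h9', -⟩
    exact ⟨h9', h1'⟩
  · rintro j hj s' ⟨h1', h2', h3', h4', h5', h6', h9', ha'⟩
    refine Runs.load_seq (Runs.call_seq (k' := 2) (runs_sizePow (a := w j) ?_ ?_ ?_ ?_ (hwL j hj)) ?_)
    · simpa [State.setReg_reg] using h2'
    · simpa [State.setReg_reg] using h3'
    · simpa [State.setReg_reg] using h5'
    · simp [State.setReg_reg, h9', ha', hw]
    · rintro s'' ⟨hr, ha, h22⟩
      have hpart : ∑ j' ∈ Finset.range (j + 1), (w j' ^ 32).size * w j' < 2 ^ L :=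
        (Finset.sum_le_sum_of_subset (Finset.range_subset_range.2 hj)).trans_lt hsum
      rw [Finset.sum_range_succ] at hpart
      have h20 : s''.reg 20 = w j := by
        rw [hr 20 le_rfl]; simp [State.setReg_reg, h9', ha', hw]
      refine Runs.mul_seq ?_ (Runs.op ?_ ?_)
      · rw [h22, h20]; omega
      · simp [State.setReg_reg, Op.eval, h22, h20, hr, h6']
        exact hpart
      · simp [State.setReg_reg, State.setReg_arr, Op.eval, h22, h20, hr, h1', h2', h3', h4', h5',
          h6', h9', ha, ha', Finset.sum_range_succ]
  · refine Runs.add_seq ?_ (Runs.call_seq (k' := 5) (runs_sizePow (a := D) ?_ ?_ ?_ ?_ hDL) ?_)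
    · rw [h4₁, h3₁]; omega
    · simpa [State.setReg_reg] using h2₁
    · simpa [State.setReg_reg] using h3₁
    · simpa [State.setReg_reg] using h5₁
    · simp [State.setReg_reg, h4₁, h3₁]
    · rintro s' ⟨hr, ha, h22⟩
      have hsz : (D ^ 32).size + 1 ≤ ((D ^ 32).size + 1) * D := Nat.le_mul_of_pos_right _ hD0
      refine Runs.add_seq ?_ (Runs.mul_seq ?_ (Runs.sub_seq (Runs.const_seq (by omega)
        (Runs.op ?_ ?_))))
      · simp [State.setReg_reg, h22, hr, h2₁]
        omega
      · simp [State.setReg_reg, h22, hr, h2₁, h4₁]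
        omega
      · simp [State.setReg_reg, Op.eval, hr, h4₁]
        omega
      · simp [State.setReg_reg, State.setReg_arr, Op.eval, hr, h4₁, h2₁, h6₁, h22, ha, ha₁]

end RAM

/-! ### Entropy from binary lengths. -/

/-- A positive integer lies between two consecutive powers of two determined by its length. Dividing
by `k` reduces the error in `logb 2 a` to `1 / k`. -/
theorem mul_logb_le_size_pow {a : ℕ} (ha : 0 < a) (k : ℕ) :
    k * Real.logb 2 a ≤ (a ^ k).size ∧ ((a ^ k).size : ℝ) ≤ k * Real.logb 2 a + 1 := by
  have ha' : (0 : ℝ) < a := by exact_mod_cast ha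
  rw [← Real.logb_pow]
  constructor
  · rw [Real.logb_le_iff_le_rpow one_lt_two (by positivity), Real.rpow_natCast]
    exact_mod_cast (Nat.lt_size_self (a ^ k)).le
  · have h1 : 0 < (a ^ k).size := Nat.size_pos.2 (by positivity)
    obtain ⟨z, hz⟩ : ∃ z, (a ^ k).size = z + 1 := ⟨_, (Nat.succ_pred_eq_of_pos h1).symm⟩
    have h2 : 2 ^ z ≤ a ^ k := Nat.lt_size.1 (by omega)
    have h3 : (z : ℝ) ≤ Real.logb 2 ((a : ℝ) ^ k) := by
      rw [Real.le_logb_iff_rpow_le one_lt_two (by positivity), Real.rpow_natCast]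
      exact_mod_cast h2
    rw [hz]
    push_cast
    linarith

theorem shannonEntropy_div {m D : ℕ} {w : Fin m → ℕ} (hD : 0 < D) (hsum : ∑ j, w j = D) :
    shannonEntropy (fun j => (w j : ℝ) / D) * D =
      D * Real.logb 2 D - ∑ j, w j * Real.logb 2 (w j) := by
  have hD' : (0 : ℝ) < D := by exact_mod_cast hD
  have hterm : ∀ j, (w j : ℝ) / D * Real.logb 2 (w j / D) * D =
      w j * Real.logb 2 (w j) - w j * Real.logb 2 D := by
    intro j
    rcases Nat.eq_zero_or_pos (w j) with h | h
    · simp [h]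
    · have h' : (0 : ℝ) < w j := by exact_mod_cast h
      rw [Real.logb_div h'.ne' hD'.ne']
      field_simp
  have hsum' : ∑ j, (w j : ℝ) = D := by exact_mod_cast hsum
  rw [shannonEntropy, neg_mul, Finset.sum_mul, Finset.sum_congr rfl fun j _ => hterm j,
    Finset.sum_sub_distrib, ← Finset.sum_mul, hsum']
  ring

theorem sum_size_mul_le {m D : ℕ} {w : Fin m → ℕ} (hsum : ∑ j, w j = D) :
    ∑ j, (w j ^ 32).size * w j ≤ (D ^ 32).size * D := by
  rw [← hsum, Finset.mul_sum]
  refine Finset.sum_le_sum fun j _ => Nat.mul_le_mul_right _ (Nat.size_le_size ?_)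
  exact Nat.pow_le_pow_left (Finset.single_le_sum (f := w) (fun _ _ => Nat.zero_le _)
    (Finset.mem_univ j)) 32

/-- Counting binary digits of 32nd powers approximates the entropy within `1 / 16`. -/
theorem shannonEntropy_div_approx {m D : ℕ} {w : Fin m → ℕ} (hD : 0 < D) (hsum : ∑ j, w j = D) :
    shannonEntropy (fun j => (w j : ℝ) / D) ≤
      (((((D ^ 32).size + 1) * D - ∑ j, (w j ^ 32).size * w j : ℕ) : ℝ) / ((D * 32 : ℕ) : ℝ)) ∧
    (((((D ^ 32).size + 1) * D - ∑ j, (w j ^ 32).size * w j : ℕ) : ℝ) / ((D * 32 : ℕ) : ℝ)) ≤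
      shannonEntropy (fun j => (w j : ℝ) / D) + 1 / 16 := by
  have hD' : (0 : ℝ) < D := by exact_mod_cast hD
  have hsum' : ∑ j, (w j : ℝ) = D := by exact_mod_cast hsum
  have hH := shannonEntropy_div hD hsum
  set H := shannonEntropy fun j => (w j : ℝ) / D
  have hle : ∑ j, (w j ^ 32).size * w j ≤ ((D ^ 32).size + 1) * D :=
    (sum_size_mul_le hsum).trans (Nat.mul_le_mul_right _ (Nat.le_succ _))
  -- The lengths of the block powers overshoot by at most `D` in total, which the extra `+ 1` in the
  -- numerator offsets, so the quotient is an upper estimate. The length of `D ^ 32` and that `+ 1`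
  -- each add at most `1 / 32`.
  obtain ⟨d1, d2⟩ := mul_logb_le_size_pow hD 32
  have s1 : ∑ j, ((w j ^ 32).size : ℝ) * w j ≤ ∑ j, (32 * (w j * Real.logb 2 (w j)) + w j) := by
    refine Finset.sum_le_sum fun j _ => ?_
    rcases Nat.eq_zero_or_pos (w j) with h | h
    · simp [h]
    · have := mul_le_mul_of_nonneg_right (mul_logb_le_size_pow h 32).2 (Nat.cast_nonneg (α := ℝ) (w j))
      push_cast at this
      linarith
  have s2 : ∑ j, 32 * (w j * Real.logb 2 (w j)) ≤ ∑ j, ((w j ^ 32).size : ℝ) * w j := by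
    refine Finset.sum_le_sum fun j _ => ?_
    rcases Nat.eq_zero_or_pos (w j) with h | h
    · simp [h]
    · have := mul_le_mul_of_nonneg_right (mul_logb_le_size_pow h 32).1 (Nat.cast_nonneg (α := ℝ) (w j))
      push_cast at this
      linarith
  rw [Finset.sum_add_distrib, ← Finset.mul_sum, hsum'] at s1
  rw [← Finset.mul_sum] at s2
  have d1' := mul_le_mul_of_nonneg_right d1 hD'.le
  have d2' := mul_le_mul_of_nonneg_right d2 hD'.le
  rw [Nat.cast_sub hle]
  push_cast at *
  constructor
  · rw [le_div_iff₀ (by positivity)]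
    linarith
  · rw [div_le_iff₀ (by positivity)]
    linarith

/-! ### Size bounds and the complete program. -/

namespace RAM

/-- The numerator of `p i` over the common denominator `∏ i, (p i).den`. -/
def commonNum {n : ℕ} (p : Fin n → ℚ) (i : Fin n) : ℕ :=
  (p i).num.natAbs * (∏ i, (p i).den) / (p i).den

theorem prod_den_pos {n : ℕ} (p : Fin n → ℚ) : 0 < ∏ i, (p i).den :=
  Finset.prod_pos fun i _ => (p i).den_pos

theorem commonNum_cast {n : ℕ} {p : Fin n → ℚ} (hp : ∀ i, 0 ≤ p i) (i : Fin n) :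
    (commonNum p i : ℚ) = p i * (∏ i, (p i).den : ℕ) := by
  have hd : (p i).den ∣ ∏ i, (p i).den := Finset.dvd_prod_of_mem _ (Finset.mem_univ i)
  have hd0 : ((p i).den : ℚ) ≠ 0 := by exact_mod_cast (p i).den_pos.ne'
  have hnum : (((p i).num.natAbs : ℕ) : ℚ) = (p i).num := by
    rw [Nat.cast_natAbs, abs_of_nonneg (Rat.num_nonneg.2 (hp i))]
  rw [commonNum, Nat.mul_div_assoc _ hd, Nat.cast_mul, Nat.cast_div hd hd0, hnum]
  nth_rewrite 3 [← Rat.num_div_den (p i)]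
  field_simp

theorem sum_commonNum {n : ℕ} {p : Fin n → ℚ} (hp : p ∈ stdSimplex ℚ (Fin n)) :
    ∑ i, commonNum p i = ∏ i, (p i).den := by
  have : ((∑ i, commonNum p i : ℕ) : ℚ) = (∏ i, (p i).den : ℕ) := by
    rw [Nat.cast_sum, Finset.sum_congr rfl fun i _ => commonNum_cast hp.1 i, ← Finset.sum_mul,
      hp.2, one_mul]
  exact_mod_cast this

theorem den_le_prod_den {n : ℕ} (p : Fin n → ℚ) (i : Fin n) : (p i).den ≤ ∏ i, (p i).den :=
  Nat.le_of_dvd (prod_den_pos p) (Finset.dvd_prod_of_mem _ (Finset.mem_univ i))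

theorem natAbs_num_le_den {n : ℕ} {p : Fin n → ℚ} (hp : p ∈ stdSimplex ℚ (Fin n)) (i : Fin n) :
    (p i).num.natAbs ≤ (p i).den := by
  have h0 := Rat.num_nonneg.2 (hp.1 i)
  have h1 : p i ≤ 1 := hp.2 ▸ Finset.single_le_sum (f := p) (fun i _ => hp.1 i) (Finset.mem_univ i)
  have := Rat.num_le_denom_iff.2 h1
  omega

theorem sum_size_den_lt_inputSize {n : ℕ} (m : ℕ) (hn : 0 < n) (p : Fin n → ℚ) :
    ∑ i, (p i).den.size < inputSize m p := by
  have := Nat.size_pos.2 hn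
  rw [inputSize, Finset.sum_add_distrib]
  omega

theorem le_inputSize {n : ℕ} (m : ℕ) (p : Fin n → ℚ) : n ≤ inputSize m p := by
  have : ∑ _i : Fin n, 1 ≤ ∑ i, ((p i).num.natAbs.size + (p i).den.size) :=
    Finset.sum_le_sum fun i _ => by
      have := Nat.size_pos.2 (p i).den_pos
      omega
  rw [Finset.sum_const, Finset.card_univ, Fintype.card_fin, smul_eq_mul, mul_one] at this
  rw [inputSize]
  omega

/-- The length of a product is at most the sum of the lengths, so the common denominator is no
longer than the input. -/
theorem prod_den_lt {n : ℕ} (m : ℕ) (hn : 0 < n) (p : Fin n → ℚ) :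
    ∏ i, (p i).den < 2 ^ inputSize m p := by
  refine lt_of_le_of_lt ?_ (Nat.pow_lt_pow_right one_lt_two (sum_size_den_lt_inputSize m hn p))
  rw [← Finset.prod_pow_eq_pow_sum]
  exact Finset.prod_le_prod' fun i _ => (Nat.lt_size_self _).le

/-- Huffman merging, followed by an approximate computation of the entropy. -/
def huffman : Prog :=
  setup ;; .while 1 8 mergeStep ;; approxEntropy

/-- A bound for the cost of `huffman`. -/
noncomputable def huffmanCost : Polynomial ℕ :=
  (.X * 13 + 8 + (.X * (.X * 17 + 20) + 1 + (.X * (120 * (.X + 1) + 12) + 120 * (.X + 1) + 16))) *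
    (1 + 3 * (40 * (.X + 1) + 1))

theorem runs_huffman {n m : ℕ} {p : Fin n → ℚ} (hm : 2 ≤ m) (hmn : m < n)
    (hp : p ∈ stdSimplex ℚ (Fin n)) :
    ∃ t s, Exec huffman (inputState m p) t s ∧ t ≤ huffmanCost.eval (inputSize m p) ∧
      IsLabelling (fun i : Fin n => s.arr 0 i) m ∧
      HuffmanRun (fun i => (p i : ℝ)) (n - m) (labelBlocks (fun i : Fin n => s.arr 0 i) m) ∧
      ∃ w : Fin m → ℕ,
        (∀ j, w j = ∑ i ∈ labelBlock (fun i : Fin n => s.arr 0 i) j, commonNum p i) ∧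
        s.reg 0 = (((∏ i, (p i).den) ^ 32).size + 1) * (∏ i, (p i).den) -
          ∑ j, (w j ^ 32).size * w j ∧
        s.reg 1 = (∏ i, (p i).den) * 32 := by
  have hnS := le_inputSize m p
  have hDS := prod_den_lt m (by omega : 0 < n) p
  have hD0 := prod_den_pos p
  have hden := den_le_prod_den p
  have hnum := natAbs_num_le_den hp
  have hsum := sum_commonNum hp
  have hcast := commonNum_cast hp.1
  have hcn : ∀ i, commonNum p i = (p i).num.natAbs * (∏ i, (p i).den) / (p i).den := fun _ => rfl
  have hprod : ∏ i ∈ Finset.range n, (inputState m p).arr 1 i = ∏ i, (p i).den := by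
    rw [Finset.prod_range]
    exact Finset.prod_congr rfl fun i _ => by simp [inputState]
  set S := inputSize m p with hS
  set D := ∏ i, (p i).den with hD
  -- A generous exponent: the largest numbers formed are 32nd powers, below `2 ^ (32 * S)`, products
  -- such as `D * D` and `((D ^ 32).size + 1) * D`, below `2 ^ (2 * S + 5)`, and `D * 32`.
  set L := 40 * (S + 1) with hL
  have hpow : ∀ e ≤ L, 2 ^ e ≤ 2 ^ L := fun e he => Nat.pow_le_pow_right two_pos he
  have hS2 : S + 1 ≤ 2 ^ S := Nat.lt_two_pow_self
  have hSL : 2 ^ S ≤ 2 ^ L := hpow S (by omega)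
  have h2L : 2 ^ 6 ≤ 2 ^ L := hpow 6 (by omega)
  have hDD : D * D < 2 ^ L := by
    refine (Nat.mul_lt_mul'' hDS hDS).trans_le ?_
    rw [← pow_add]
    exact hpow _ (by omega)
  have hpow32 : ∀ a ≤ D, a ^ 32 < 2 ^ (32 * S) := by
    intro a ha
    rw [mul_comm, pow_mul]
    exact Nat.pow_lt_pow_left (ha.trans_lt hDS) (by omega)
  have h32L : 2 ^ (32 * S) ≤ 2 ^ L := hpow _ (by omega)
  have hD32 : D * 32 < 2 ^ L := by
    have : 2 ^ (S + 5) ≤ 2 ^ L := hpow _ (by omega)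
    rw [pow_add] at this
    omega
  have hsizeD : (D ^ 32).size ≤ 32 * S := Nat.size_le.2 (hpow32 D le_rfl)
  have hsize : ((D ^ 32).size + 1) * D < 2 ^ L := by
    have h1 : (D ^ 32).size + 1 ≤ 2 ^ (S + 5) := by
      rw [pow_add]
      omega
    have h2 : 2 ^ (S + 5) * 2 ^ S ≤ 2 ^ L := by
      rw [← pow_add]
      exact hpow _ (by omega)
    exact ((Nat.mul_le_mul_right D h1).trans_lt
      (Nat.mul_lt_mul_of_pos_left hDS (by positivity))).trans_le h2
  have hbdd : (inputState m p).Bounded (2 ^ L) := by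
    refine ⟨fun x => ?_, fun a i => ?_⟩
    · simp only [inputState]
      split_ifs <;> omega
    · simp only [inputState]
      split_ifs with h
      · have := hnum ⟨i, h⟩
        have := hden ⟨i, h⟩
        omega
      · have := hden ⟨i, h⟩
        omega
      · omega
      · omega
  have hrun : Runs (2 ^ L)
      ((n * 13 + 8) + ((n * (n * 17 + 20) + 1) + (m * (L * 3 + 12) + L * 3 + 16)))
      huffman (inputState m p) fun s =>
        IsLabelling (fun i : Fin n => s.arr 0 i) m ∧
        HuffmanRun (fun i => (p i : ℝ)) (n - m) (labelBlocks (fun i : Fin n => s.arr 0 i) m) ∧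
        ∃ w : Fin m → ℕ,
          (∀ j, w j = ∑ i ∈ labelBlock (fun i : Fin n => s.arr 0 i) j, commonNum p i) ∧
          s.reg 0 = ((D ^ 32).size + 1) * D - ∑ j, (w j ^ 32).size * w j ∧ s.reg 1 = D * 32 := by
    refine Runs.call_seq (runs_setup (D := D) (by simp [inputState]) (by simp [inputState])
      (by omega) (by omega) (fun i hi => ?_) (fun i hi => ?_) hprod hDD) ?_
    · simpa [inputState, hi] using (p ⟨i, hi⟩).den_pos
    · simpa [inputState, hi] using (hnum ⟨i, hi⟩).trans (hden ⟨i, hi⟩)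
    rintro s₁ ⟨h0₁, h1₁, h2₁, h3₁, h4₁, h5₁, h8₁, ha₁⟩
    refine Runs.call_seq (runs_mergeLoop (m := m) (D := D) (p := fun i => (p i : ℝ))
      (a := commonNum p) (by omega) hmn (by omega) (by omega) (fun i => ?_) hsum h0₁
      (by rw [h1₁]; simp [inputState]) h2₁ h3₁ h8₁ fun i => ?_) ?_
    · have hD' : (D : ℝ) ≠ 0 := by exact_mod_cast hD0.ne'
      rw [eq_div_iff hD']
      exact_mod_cast (hcast i).symm
    · obtain ⟨e0, e2, e3⟩ := ha₁ i i.2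
      refine ⟨e0, ?_, e3⟩
      rw [e2, hcn]
      simp [inputState]
    rintro s₂ ⟨hr₂, hF, hrun, hw⟩
    have hwsum : ∑ j : Fin m, s₂.arr 2 j = D := by
      rw [← hsum, ← Finset.sum_fiberwise (s := Finset.univ)
        (g := fun i : Fin n => (⟨s₂.arr 0 i, hF.1 i⟩ : Fin m))]
      refine Finset.sum_congr rfl fun j _ => ?_
      rw [hw j j.2]
      refine Finset.sum_congr ?_ fun _ _ => rfl
      ext i
      simp [mem_labelBlock, Fin.ext_iff]
    have hwle : ∀ j < m, s₂.arr 2 j ≤ D := fun j hj => hwsum ▸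
      Finset.single_le_sum (f := fun j : Fin m => s₂.arr 2 j) (fun _ _ => Nat.zero_le _)
        (Finset.mem_univ ⟨j, hj⟩)
    have hsizesum : ∑ j ∈ Finset.range m, (s₂.arr 2 j ^ 32).size * s₂.arr 2 j < 2 ^ L := by
      rw [Finset.sum_range]
      refine ((sum_size_mul_le hwsum).trans ?_).trans_lt hsize
      exact Nat.mul_le_mul_right D (Nat.le_succ _)
    refine (runs_approxEntropy (m := m) (D := D) (by rw [hr₂ 1 (by omega), h1₁]; simp [inputState])
      (by rw [hr₂ 2 (by omega), h2₁]) (by rw [hr₂ 3 (by omega), h3₁])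
      (by rw [hr₂ 4 (by omega), h4₁]) (by rw [hr₂ 5 (by omega), h5₁]) rfl (by omega)
      (fun j hj => (hpow32 _ (hwle j hj)).trans_le h32L) ((hpow32 D le_rfl).trans_le h32L)
      hsizesum hsize hD0 hD32).mono le_rfl ?_
    rintro s ⟨ha, h0, h1⟩
    rw [ha]
    refine ⟨hF, hrun, fun j => s₂.arr 2 j, fun j => hw j j.2, ?_, h1⟩
    rw [h0, Finset.sum_range]
  obtain ⟨t, s, hexec, ht, -, hpost⟩ := hrun hbdd
  refine ⟨t, s, hexec, ht.trans ?_, hpost⟩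
  -- `2 ^ L` has `L + 1` binary digits, which is the last factor of `huffmanCost`.
  rw [Nat.size_pow]
  have hmS : m ≤ S := by omega
  simp only [huffmanCost, Polynomial.eval_mul, Polynomial.eval_add, Polynomial.eval_X,
    Polynomial.eval_ofNat, Polynomial.eval_one]
  have hL3 : L * 3 = 120 * (S + 1) := by omega
  rw [hL3]
  gcongr

end RAM

theorem corollary1 :
    alphaConst < 0.0861 ∧
    (∀ (n m : ℕ) (p : Fin n → ℝ), 2 ≤ m → m < n → p ∈ stdSimplex ℝ (Fin n) →
      (∃ f : Fin n → Fin m, IsHuffmanFun p f) ∧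
      ∃ M : ℝ, IsGreatest (entropyValues m p) M ∧
        ∀ f : Fin n → Fin m, IsHuffmanFun p f →
          M - alphaConst ≤ shannonEntropy (distOfFun p f) ∧
          shannonEntropy (distOfFun p f) ≤ M) ∧
    ∃ (P : RAM.Prog) (T : Polynomial ℕ),
      ∀ (n m : ℕ) (p : Fin n → ℚ), 2 ≤ m → m < n → p ∈ stdSimplex ℚ (Fin n) →
        ∃ (t : ℕ) (s : RAM.State) (f : Fin n → Fin m) (v : ℚ) (M : ℝ),
          RAM.Exec P (RAM.inputState m p) t s ∧
          t ≤ T.eval (RAM.inputSize m p) ∧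
          RAM.IsOutput s f v ∧
          IsHuffmanFun (fun i => (p i : ℝ)) f ∧
          IsGreatest (entropyValues m fun i => (p i : ℝ)) M ∧
          M - alphaConst ≤ shannonEntropy (distOfFun (fun i => (p i : ℝ)) f) ∧
          shannonEntropy (distOfFun (fun i => (p i : ℝ)) f) ≤ M ∧
          |(v : ℝ) - M| ≤ alphaConst := by
  refine ⟨alphaConst_lt, fun n m p hm hmn hp => ?_, RAM.huffman, RAM.huffmanCost,
    fun n m p hm hmn hp => ?_⟩
  · obtain ⟨f, hf⟩ := exists_isHuffmanFun p hm hmn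
    obtain ⟨M, hM⟩ := exists_isGreatest_entropyValues p f hf.1
    exact ⟨⟨f, hf⟩, M, hM, fun g hg => hg.entropy_bounds hmn hp hM⟩
  · obtain ⟨t, s, hexec, ht, hF, hrun, w, hw, h0, h1⟩ := RAM.runs_huffman hm hmn hp
    have hp' : (fun i => (p i : ℝ)) ∈ stdSimplex ℝ (Fin n) :=
      ⟨fun i => Rat.cast_nonneg.2 (hp.1 i), by simpa using congrArg (Rat.cast (K := ℝ)) hp.2⟩
    have hf := isHuffmanFun_of_labelling hF hrun
    set f : Fin n → Fin m := fun i => ⟨s.arr 0 i, hF.1 i⟩ with hfdef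
    obtain ⟨M, hM⟩ := exists_isGreatest_entropyValues (fun i => (p i : ℝ)) f hf.1
    have hD0 := RAM.prod_den_pos p
    have hcast := RAM.commonNum_cast hp.1
    have hsum := RAM.sum_commonNum hp
    set D := ∏ i, (p i).den
    have hD' : (D : ℝ) ≠ 0 := by exact_mod_cast hD0.ne'
    have hblock : ∀ j : Fin m, labelBlock (fun i : Fin n => s.arr 0 i) j =
        Finset.univ.filter fun i => f i = j := by
      intro j
      ext i
      simp [mem_labelBlock, hfdef, Fin.ext_iff]
    have hwsum : ∑ j, w j = D := by
      rw [← hsum, ← Finset.sum_fiberwise (s := Finset.univ) (g := f)]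
      exact Finset.sum_congr rfl fun j _ => by rw [hw j, hblock]
    have hdist : distOfFun (fun i => (p i : ℝ)) f = fun j => (w j : ℝ) / D := by
      funext j
      rw [distOfFun, hw j, hblock, Nat.cast_sum, Finset.sum_div]
      refine Finset.sum_congr rfl fun i _ => ?_
      rw [eq_div_iff hD']
      exact_mod_cast (hcast i).symm
    obtain ⟨hlo, hhi⟩ := hf.entropy_bounds hmn hp' hM
    obtain ⟨hv1, hv2⟩ := shannonEntropy_div_approx hD0 hwsum
    rw [← hdist, ← h0, ← h1] at hv1 hv2
    refine ⟨t, s, f, (s.reg 0 : ℚ) / (s.reg 1 : ℚ), M, hexec, ht, ⟨fun i => rfl, ?_, rfl⟩, hf, hM,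
      hlo, hhi, ?_⟩
    · rw [h1]
      omega
    -- With `H` the entropy of `f(X)`, `M - α ≤ H ≤ v ≤ H + 1/16 ≤ M + α`.
    · have := le_alphaConst
      push_cast
      rw [abs_le]
      constructor <;> linarith
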